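/- Let $k$ be a field and let $Q$ be a toupie quiver: a finite quiver without oriented cycles that has a unique source $0$ and a unique sink $\omega$, and in which every other vertex is the source of exactly one arrow and the target of exactly one arrow. Paths are composed from left to right, and the paths from $0$ to $\omega$ are called branches. Let $I\subset kQ$ be an admissible ideal, $A=kQ/I$ the corresponding toupie algebra, $e_x$ the idempotent of the vertex $x$, $E=\bigoplus_x ke_x$ and $\overline A=A/E$ (the quotient $E$-bimodule). Fix a linear order $\alpha^{(1)}<\alpha^{(2)}<\cdots$ of the branches. Call a branch irreducible if its class in $A$ is not a linear combination of the classes of later branches, and call any other path irreducible if its class in $A$ is nonzero; let $\mathcal B$ be the set of irreducible paths, which gives a basis of $A$. Let $\mathcal R$ be the following minimal set of generators of $I$: the paths in $I$ that have no proper subpath in $I$, and the elements $W-f\in I$ with $W$ a branch not in $I$ and $f$ a linear combination of irreducible branches later than $W$ (the reduced row echelon form of the non-monomial relations). The minimal resolution of the $A$-bimodule $A$ begins with $$A\otimes_E k\mathcal R\otimes_E A\xrightarrow{d_1}A\otimes_E kQ_1\otimes_E A\xrightarrow{d_0}A\otimes_E A,$$ where $d_0(1\otimes\alpha\otimes1)=\alpha\otimes1-1\otimes\alpha$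 and $d_1(1\otimes r\otimes 1)=\sum r^{(1)}\otimes r^{(2)}\otimes r^{(3)}$, extended linearly from paths, the sum being over the factorizations of a path with $r^{(2)}$ an arrow. Applying $\mathrm{Hom}_{A^e}(-,A)$ gives the complex $\mathrm{Hom}_{E^e}(E,A)\xrightarrow{D_0}\mathrm{Hom}_{E^e}(kQ_1,A)\xrightarrow{D_1}\mathrm{Hom}_{E^e}(k\mathcal R,A)$. Let $\varphi_1:A\otimes_E kQ_1\otimes_E A\to A\otimes_E\overline A\otimes_E A$ be the bimodule map with $\varphi_1(1\otimes\alpha\otimes1)=1\otimes\overline\alpha\otimes1$, and let $\eta_1$ be the bimodule map in the opposite direction with $\eta_1(1\otimes\overline b\otimes1)=\sum b^{(1)}\otimes b^{(2)}\otimes b^{(3)}$ for $b\in\mathcal B$ (the sum over the factorizations with $b^{(2)}$ an arrow). Then $\eta_1$ exists and is unique, and with $\delta_0(1\otimes\overline a\otimes1)=a\otimes1-1\otimes a$ one has $d_0\eta_1=\delta_0$ and $\delta_0\varphi_1=d_0$; moreover $D_1D_0=0$. For an arrow $\alpha$ and a path $h\in\mathcal B$ parallel to $\alpha$ let $\alpha\|h\in\mathrm{Hom}_{E^e}(kQ_1,A)$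 be the map that sends $\alpha$ to $h$ and all other arrows to $0$; these elements span $\mathrm{Hom}_{E^e}(kQ_1,A)$. For a path $b$ let $b^{\alpha\|h}\in A$ be the sum of the classes of all paths obtained by replacing an occurrence of $\alpha$ in $b$ by $h$ (so $b^{\alpha\|h}=0$ if $\alpha$ does not occur in $b$). For $x\in A$ let $\alpha\|x$ likewise denote the map $kQ_1\to A$ with $\alpha\mapsto x$ and all other arrows $\mapsto0$. Define the bilinear bracket $[F,G]=\varphi_1^*[\eta_1^*F,\eta_1^*G]$ on $\mathrm{Hom}_{E^e}(kQ_1,A)$, where on $\mathrm{Hom}_{E^e}(\overline A,A)$ the bracket $[f,g]=f\circ g-g\circ f$, $(f\circ g)(\overline a)=f(\overline{g(\overline a)})$, is the reduced Gerstenhaber bracket. Then 1. for all arrows $\alpha,\beta$ and all $h,b\in\mathcal B$ with $h$ parallel to $\alpha$ and $b$ parallel to $\beta$, $$[\alpha\|h,\beta\|b]=\beta\|b^{\alpha\|h}-\alpha\|h^{\beta\|b};$$ 2. $\eta_1^*$ and $\varphi_1^*$ induce mutually inverse isomorphisms between $\operatorname{Ker}D_1/\operatorname{Im}D_0$ and $\mathrm{HH}^1(A)$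 (derivations of $A$ modulo inner derivations), the bracket above maps $\operatorname{Ker}D_1\times\operatorname{Ker}D_1$ into $\operatorname{Ker}D_1$, and under these isomorphisms it induces the Gerstenhaber bracket of $\mathrm{HH}^1(A)$. -/

import Mathlib

open scoped TensorProduct

noncomputable section

namespace Toupie

/-! ### First Hochschild cohomology and its Gerstenhaber bracket -/

section Hochschild

attribute [local instance] LieRing.ofAssociativeRing

variable (k A : Type*) [Field k] [Ring A] [Algebra k A]

/-- The Hochschild differential `C⁰(A) = A → C¹(A) = Hom_k(A, A)`, `a ↦ (x ↦ x a - a x)`. -/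
def hochD0 : A →ₗ[k] Module.End k A :=
  (LinearMap.mul k A).flip - LinearMap.mul k A

/-- The Hochschild differential `C¹(A) → C²(A) = Hom_k(A, Hom_k(A, A))`,
`f ↦ (x ⊗ y ↦ x f(y) - f(x y) + f(x) y)`. -/
def hochD1 : Module.End k A →ₗ[k] A →ₗ[k] A →ₗ[k] A where
  toFun f := LinearMap.mk₂ k (fun x y => x * f y - f (x * y) + f x * y)
    (by intros; simp [add_mul]; abel) (by intros; simp [smul_sub, smul_add])
    (by intros; simp [mul_add]; abel) (by intros; simp [smul_sub, smul_add])
  map_add' f g := by ext; simp [mul_add, add_mul]; abel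
  map_smul' c f := by ext; simp [smul_sub, smul_add]

variable {k A} in
theorem hochD1_apply (f : Module.End k A) (x y : A) :
    hochD1 k A f x y = x * f y - f (x * y) + f x * y := rfl

variable {k A} in
theorem hochD1_eq_zero (f : Module.End k A) :
    hochD1 k A f = 0 ↔ ∀ x y, f (x * y) = x * f y + f x * y := by
  constructor
  · intro h x y
    have := congrArg (fun g => g x y) h
    simp only [hochD1_apply, LinearMap.zero_apply] at this
    rw [← sub_eq_zero, ← neg_eq_zero, ← this]; abel
  · intro h
    ext x y
    rw [hochD1_apply, h]; simp

/-- The Hochschild `1`-cocycles, with the Gerstenhaber bracket of degree one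
`[f, g] = f ∘ g - g ∘ f`, which is the commutator of `Module.End k A`. -/
def hochZ1 : LieSubalgebra k (Module.End k A) :=
  { LinearMap.ker (hochD1 k A) with
    lie_mem' := by
      intro f g hf hg
      have hf' := (hochD1_eq_zero f).1 hf
      have hg' := (hochD1_eq_zero g).1 hg
      refine (hochD1_eq_zero _).2 fun x y => ?_
      simp only [LieRing.of_associative_ring_bracket, LinearMap.sub_apply, Module.End.mul_apply,
        hf', hg', map_add]
      noncomm_ring }

variable {k A} in
theorem mem_hochZ1 (f : Module.End k A) :
    f ∈ hochZ1 k A ↔ ∀ x y, f (x * y) = x * f y + f x * y := hochD1_eq_zero f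

/-- The Hochschild `1`-coboundaries, a Lie ideal of the `1`-cocycles. -/
def hochB1 : LieIdeal k (hochZ1 k A) :=
  { (LinearMap.range (hochD0 k A)).comap (hochZ1 k A).subtype with
    lie_mem := by
      rintro ⟨f, hf⟩ ⟨g, hg⟩ ⟨a, ha⟩
      refine ⟨f a, ?_⟩
      have hf' := (mem_hochZ1 f).1 hf
      have ha' : hochD0 k A a = g := ha
      ext x
      change hochD0 k A (f a) x = f (g x) - g (f x)
      rw [← ha']
      simp only [hochD0, LinearMap.sub_apply, LinearMap.flip_apply, LinearMap.mul_apply', map_sub,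
        hf']
      abel }

/-- `HH¹(A)`, with the Lie bracket induced by the Gerstenhaber bracket of cochains. -/
abbrev HH1 : Type _ := hochZ1 k A ⧸ hochB1 k A

end Hochschild

/-! ### Bimodules `A ⊗_E M ⊗_E A` over the semisimple subalgebra `E = ⊕ k e_v` -/

section Bimodules

/-- The left and right actions `m ↦ e_v m` and `m ↦ m e_v` of the vertices on an `E`-bimodule. -/
class VertexAction (k V M : Type*) [Field k] [AddCommGroup M] [Module k M] where
  left : V → M →ₗ[k] M
  right : V → M →ₗ[k] M

/-- A set of symbols with a source and a target in `V`. -/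
class Ends (X : Type*) (V : outParam (Type*)) where
  src : X → V
  tgt : X → V

open Classical in
/-- The `E`-bimodule `k X` on a set of symbols: `e_v x = x` if `v` is the source of `x`, and `0`
otherwise; `x e_v = x` if `v` is the target of `x`, and `0` otherwise. -/
instance spanAction (k : Type*) {X V : Type*} [Field k] [Ends X V] : VertexAction k V (X →₀ k) where
  left v := Finsupp.linearCombination k
    fun x => if Ends.src x = v then Finsupp.single x (1 : k) else 0
  right v := Finsupp.linearCombination k
    fun x => if Ends.tgt x = v then Finsupp.single x (1 : k) else 0

/-- The `E`-bimodule `E = k Q₀` itself. -/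
instance vertexEnds (V : Type*) : Ends V V := ⟨id, id⟩

/-- The enveloping algebra `A ⊗ Aᵒᵖ`. -/
def Env (k A : Type*) [Field k] [Ring A] [Algebra k A] : Type _ := A ⊗[k] Aᵐᵒᵖ

instance envRing (k A : Type*) [Field k] [Ring A] [Algebra k A] : Ring (Env k A) :=
  inferInstanceAs (Ring (A ⊗[k] Aᵐᵒᵖ))

instance envAlgebra (k A : Type*) [Field k] [Ring A] [Algebra k A] : Algebra k (Env k A) :=
  inferInstanceAs (Algebra k (A ⊗[k] Aᵐᵒᵖ))

variable {k A V : Type*} [Field k] [Ring A] [Algebra k A]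

/-- `A` as a bimodule over itself: `(a ⊗ b) x = a x b`. -/
instance envModule : Module (Env k A) A := instModuleTensorProductMop k A

/-- The element `a ⊗ b` of the enveloping algebra, acting as `x ↦ a x b`. -/
def env (k : Type*) {A : Type*} [Field k] [Ring A] [Algebra k A] (a b : A) : Env k A :=
  (a ⊗ₜ MulOpposite.op b : A ⊗[k] Aᵐᵒᵖ)

theorem env_smul (a b x : A) : env k a b • x = a * x * b := by
  rw [mul_assoc]
  exact TensorProduct.Algebra.smul_def a (MulOpposite.op b) x

theorem env_mul (a b c d : A) : env k a b * env k c d = env k (a * c) (d * b) := by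
  refine (Algebra.TensorProduct.tmul_mul_tmul (R := k) a c (MulOpposite.op b)
    (MulOpposite.op d)).trans ?_
  rfl

theorem env_induction {p : Env k A → Prop} (x : Env k A) (h : ∀ a b, p (env k a b))
    (h0 : p 0) (hadd : ∀ x y, p x → p y → p (x + y)) : p x :=
  TensorProduct.induction_on (motive := p) x h0 (fun a b => h a b.unop) hadd

theorem smul_env (c : k) (a b : A) : c • env k a b = env k (c • a) b :=
  TensorProduct.smul_tmul' c a (MulOpposite.op b)

instance envTower : IsScalarTower k (Env k A) A := by
  refine ⟨fun c x y => ?_⟩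
  induction x using env_induction with
  | h0 => simp
  | hadd x y hx hy => simp only [smul_add, add_smul, hx, hy]
  | h a b => rw [smul_env, env_smul, env_smul]; simp

/-- The element `a ⊗ 1` of the enveloping algebra, acting by left multiplication by `a`. -/
def lm (k : Type*) {A : Type*} [Field k] [Ring A] [Algebra k A] : A →ₗ[k] Env k A where
  toFun a := env k a 1
  map_add' a b := TensorProduct.add_tmul a b (1 : Aᵐᵒᵖ)
  map_smul' c a := (smul_env c a 1).symm

/-- The element `1 ⊗ a` of the enveloping algebra, acting by right multiplication by `a`. -/
def rm (k : Type*) {A : Type*} [Field k] [Ring A] [Algebra k A] : A →ₗ[k] Env k A where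
  toFun a := env k 1 a
  map_add' a b := TensorProduct.tmul_add (1 : A) (MulOpposite.op a) (MulOpposite.op b)
  map_smul' c a := TensorProduct.tmul_smul c (1 : A) (MulOpposite.op a)

theorem lm_smul (a x : A) : lm k a • x = a * x :=
  (env_smul a 1 x).trans (mul_one _)

theorem rm_smul (a x : A) : rm k a • x = x * a :=
  (env_smul 1 a x).trans (by rw [one_mul])

theorem lm_mul (a b : A) : lm k (a * b) = lm k a * lm k b :=
  ((env_mul a 1 b 1).trans (by rw [mul_one]; rfl)).symm

theorem rm_mul (a b : A) : rm k (a * b) = rm k b * rm k a :=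
  ((env_mul 1 b 1 a).trans (by rw [mul_one]; rfl)).symm

theorem rm_lm (a b : A) : rm k b * lm k a = lm k a * rm k b := by
  refine (env_mul 1 b a 1).trans ((env_mul a 1 1 b).trans ?_).symm
  simp

variable (e : V → A) (M : Type*) [AddCommGroup M] [Module k M] [VertexAction k V M]
  (P : Type*) [AddCommGroup P] [Module k P] [Module (Env k A) P] [IsScalarTower k (Env k A) P]

variable (k) in
/-- `Hom_{Eᵉ}(M, P)` for an `E`-bimodule `M` and an `A`-bimodule `P`, as a subspace of
`Hom_k(M, P)`. -/
def homESub : Submodule k (M →ₗ[k] P) where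
  carrier := {f | ∀ (v : V) (m : M), f (VertexAction.left (k := k) v m) = lm k (e v) • f m ∧
    f (VertexAction.right (k := k) v m) = rm k (e v) • f m}
  add_mem' hf hg v m := by simp [(hf v m).1, (hf v m).2, (hg v m).1, (hg v m).2]
  zero_mem' v m := by simp
  smul_mem' c f hf v m := by simp [(hf v m).1, (hf v m).2, smul_comm c]

variable (k) in
/-- `Hom_{Eᵉ}(M, P)`: the linear maps `f : M → P` with `f(e_v m) = e_v f(m)` and
`f(m e_v) = f(m) e_v`. -/
def HomE : Type _ := homESub k e M P

instance homEGroup : AddCommGroup (HomE k e M P) := inferInstanceAs (AddCommGroup (homESub k e M P))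

instance homEModule : Module k (HomE k e M P) := inferInstanceAs (Module k (homESub k e M P))

namespace HomE

variable {M P e}

/-- The underlying linear map. -/
def toHom : HomE k e M P →ₗ[k] M →ₗ[k] P := (homESub k e M P).subtype

/-- A linear map that is compatible with the vertices, as an element of `Hom_{Eᵉ}(M, P)`. -/
def ofHom (f : M →ₗ[k] P) (hf : ∀ (v : V) (m : M),
    f (VertexAction.left (k := k) v m) = lm k (e v) • f m ∧
    f (VertexAction.right (k := k) v m) = rm k (e v) • f m) : HomE k e M P :=
  (⟨f, hf⟩ : homESub k e M P)

@[simp]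
theorem toHom_ofHom (f : M →ₗ[k] P) (hf) : toHom (ofHom (e := e) f hf) = f := rfl

theorem toHom_left (f : HomE k e M P) (v : V) (m : M) :
    toHom f (VertexAction.left (k := k) v m) = lm k (e v) • toHom f m := (f.2 v m).1

theorem toHom_right (f : HomE k e M P) (v : V) (m : M) :
    toHom f (VertexAction.right (k := k) v m) = rm k (e v) • toHom f m := (f.2 v m).2

theorem ext {f g : HomE k e M P} (h : ∀ m, toHom f m = toHom g m) : f = g :=
  Subtype.ext (LinearMap.ext h)

end HomE

variable (k) in
/-- The relations `a e_v ⊗ m ⊗ b = a ⊗ e_v m ⊗ b` and `a ⊗ m e_v ⊗ b = a ⊗ m ⊗ e_v b`, as a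
subbimodule of `A ⊗_k M ⊗_k A`, which is written as `(A ⊗ Aᵒᵖ) ⊗ M`. -/
def balanced : Submodule (Env k A) (Env k A ⊗[k] M) :=
  Submodule.span (Env k A) {x | ∃ (v : V) (m : M),
    x = lm k (e v) ⊗ₜ m - 1 ⊗ₜ VertexAction.left (k := k) v m ∨
    x = rm k (e v) ⊗ₜ m - 1 ⊗ₜ VertexAction.right (k := k) v m}

variable (k) in
/-- The `A`-bimodule `A ⊗_E M ⊗_E A`. -/
abbrev BT : Type _ := (Env k A ⊗[k] M) ⧸ balanced k e M

variable {M} in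
variable (k) in
/-- The element `1 ⊗ m ⊗ 1` of `A ⊗_E M ⊗_E A`. -/
def gen : M →ₗ[k] BT k e M :=
  (balanced k e M).mkQ.restrictScalars k ∘ₗ TensorProduct.mk k (Env k A) M 1

variable {M}

theorem gen_left (v : V) (m : M) :
    gen k e (VertexAction.left (k := k) v m) = lm k (e v) • gen k e m := by
  symm
  refine (Submodule.Quotient.eq (balanced k e M)).2 ?_
  refine Submodule.subset_span ⟨v, m, Or.inl ?_⟩
  simp [TensorProduct.smul_tmul']

theorem gen_right (v : V) (m : M) :
    gen k e (VertexAction.right (k := k) v m) = rm k (e v) • gen k e m := by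
  symm
  refine (Submodule.Quotient.eq (balanced k e M)).2 ?_
  refine Submodule.subset_span ⟨v, m, Or.inr ?_⟩
  simp [TensorProduct.smul_tmul']

variable {P} {e}

/-- The bimodule map `a ⊗ m ⊗ b ↦ a f(m) b` on `A ⊗_k M ⊗_k A`. -/
def liftAux (f : M →ₗ[k] P) : Env k A ⊗[k] M →ₗ[Env k A] P :=
  TensorProduct.AlgebraTensorModule.lift
    ((LinearMap.toSpanSingleton (Env k A) (M →ₗ[k] P) f))

theorem liftAux_tmul (f : M →ₗ[k] P) (x : Env k A) (m : M) : liftAux f (x ⊗ₜ m) = x • f m := by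
  simp [liftAux]

/-- The bimodule map `a ⊗ m ⊗ b ↦ a f(m) b` on `A ⊗_E M ⊗_E A`. -/
def lift (f : HomE k e M P) : BT k e M →ₗ[Env k A] P :=
  (balanced k e M).liftQ (liftAux (HomE.toHom f)) <| Submodule.span_le.2 <| by
    rintro x ⟨v, m, rfl | rfl⟩
    · simp [liftAux_tmul, HomE.toHom_left]
    · simp [liftAux_tmul, HomE.toHom_right]

theorem lift_gen (f : HomE k e M P) (m : M) : lift f (gen k e m) = HomE.toHom f m := by
  have : lift f (gen k e m) = liftAux (HomE.toHom f) (1 ⊗ₜ m) := rfl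
  rw [this, liftAux_tmul, one_smul]

/-- The canonical isomorphism `F : Hom_{Aᵉ}(A ⊗_E M ⊗_E A, P) ≃ Hom_{Eᵉ}(M, P)`,
`F(φ)(m) = φ(1 ⊗ m ⊗ 1)`. -/
def homF : (BT k e M →ₗ[Env k A] P) ≃ₗ[k] HomE k e M P where
  toFun φ := HomE.ofHom (φ.restrictScalars k ∘ₗ gen k e) fun v m => by
    simp [gen_left, gen_right]
  map_add' _ _ := rfl
  map_smul' _ _ := rfl
  invFun := lift
  left_inv φ := by
    refine LinearMap.ext fun x => ?_
    obtain ⟨x, rfl⟩ := (balanced k e M).mkQ_surjective x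
    induction x with
    | zero => simp
    | add x y hx hy => rw [map_add, map_add, map_add, hx, hy]
    | tmul a m =>
      have h : (balanced k e M).mkQ (a ⊗ₜ m) = a • gen k e m := by
        change _ = (balanced k e M).mkQ (a • (1 ⊗ₜ m))
        rw [TensorProduct.smul_tmul', smul_eq_mul, mul_one]
      rw [h, map_smul, map_smul, lift_gen]
      rfl
  right_inv f := by
    exact HomE.ext fun m => lift_gen f m

section Symbols

open Classical in
theorem left_single {X : Type*} [Ends X V] (v : V) (x : X) :
    VertexAction.left (k := k) v (Finsupp.single x (1 : k)) =
      if Ends.src x = v then Finsupp.single x (1 : k) else 0 :=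
  (Finsupp.linearCombination_single k (1 : k) x).trans (one_smul k _)

open Classical in
theorem right_single {X : Type*} [Ends X V] (v : V) (x : X) :
    VertexAction.right (k := k) v (Finsupp.single x (1 : k)) =
      if Ends.tgt x = v then Finsupp.single x (1 : k) else 0 :=
  (Finsupp.linearCombination_single k (1 : k) x).trans (one_smul k _)

open Classical in
/-- The element of `Hom_{Eᵉ}(k X, P)` with prescribed values on the symbols. -/
def onSymbols {X : Type*} [Ends X V] (f : X → P)
    (hl : ∀ v x, lm k (e v) • f x = if Ends.src x = v then f x else 0)
    (hr : ∀ v x, rm k (e v) • f x = if Ends.tgt x = v then f x else 0) :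
    HomE k e (X →₀ k) P :=
  HomE.ofHom (Finsupp.linearCombination k f) fun v m => by
    induction m using Finsupp.induction_linear with
    | zero => simp
    | add m m' h h' => simp [h.1, h.2, h'.1, h'.2]
    | single x c =>
      have hc : (Finsupp.single x c : X →₀ k) = c • Finsupp.single x 1 := by simp
      rw [hc]
      simp only [map_smul, left_single, right_single, apply_ite (Finsupp.linearCombination k f),
        Finsupp.linearCombination_single, one_smul, map_zero, smul_comm _ c, hl, hr, and_self]

end Symbols

/-- The map `Hom_{Eᵉ}(N, A) → Hom_{Eᵉ}(M, A)` induced by a bimodule map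
`d : A ⊗_E M ⊗_E A → A ⊗_E N ⊗_E A`, that is, `F ∘ Hom_{Aᵉ}(d, A) ∘ F⁻¹`. -/
def pull {N : Type*} [AddCommGroup N] [Module k N] [VertexAction k V N]
    (d : BT k e M →ₗ[Env k A] BT k e N) : HomE k e N A →ₗ[k] HomE k e M A :=
  homF.toLinearMap ∘ₗ LinearMap.lcomp k A d ∘ₗ homF.symm.toLinearMap

end Bimodules

/-! ### Path algebras -/

section PathAlgebra

universe u v

/-- A path in a quiver, with its endpoints. -/
structure QPath (V : Type u) [Quiver.{v} V] where
  src : V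
  tgt : V
  path : Quiver.Path src tgt

/-- An arrow in a quiver, with its endpoints. -/
structure Arrow (V : Type u) [Quiver.{v} V] where
  src : V
  tgt : V
  hom : src ⟶ tgt

instance arrowEnds (V : Type u) [Quiver.{v} V] : Ends (Arrow V) V := ⟨Arrow.src, Arrow.tgt⟩

/-- The underlying vector space of the path algebra `k Q`, with basis the paths of `Q`. -/
def PathAlgebra (k : Type*) (V : Type u) [Field k] [Quiver.{v} V] : Type _ := QPath V →₀ k

variable {k : Type*} {V : Type u} [Field k] [Quiver.{v} V]

namespace PathAlgebra

instance : AddCommGroup (PathAlgebra k V) := inferInstanceAs (AddCommGroup (QPath V →₀ k))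

instance : Module k (PathAlgebra k V) := inferInstanceAs (Module k (QPath V →₀ k))

variable (k) in
/-- A path as an element of the path algebra. -/
def of {a b : V} (p : Quiver.Path a b) : PathAlgebra k V := Finsupp.single ⟨a, b, p⟩ (1 : k)

/-- The linear map on `k Q` with prescribed values on paths. -/
def extend {N : Type*} [AddCommGroup N] [Module k N] (f : QPath V → N) : PathAlgebra k V →ₗ[k] N :=
  Finsupp.linearCombination k f

@[simp]
theorem extend_of {N : Type*} [AddCommGroup N] [Module k N] (f : QPath V → N) {a b : V}
    (p : Quiver.Path a b) : extend f (of k p) = f ⟨a, b, p⟩ := by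
  exact (Finsupp.linearCombination_single k (1 : k) _).trans (one_smul k _)

theorem hom_ext {N : Type*} [AddCommGroup N] [Module k N] {f g : PathAlgebra k V →ₗ[k] N}
    (h : ∀ (a b : V) (p : Quiver.Path a b), f (of k p) = g (of k p)) : f = g :=
  Finsupp.lhom_ext' fun ⟨a, b, p⟩ => LinearMap.ext_ring (h a b p)

open Classical in
variable (k) in
/-- The product of two paths: their concatenation `p q` if `p` ends where `q` starts, and `0`
otherwise. -/
def mulPath (p q : QPath V) : PathAlgebra k V :=
  if h : q.src = p.tgt then of k (p.path.comp (q.path.cast h rfl)) else 0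

variable (k V) in
/-- The multiplication of the path algebra. -/
def mulHom : PathAlgebra k V →ₗ[k] PathAlgebra k V →ₗ[k] PathAlgebra k V :=
  extend fun p => extend fun q => mulPath k p q

theorem mulHom_comp {a b c : V} (p : Quiver.Path a b) (q : Quiver.Path b c) :
    mulHom k V (of k p) (of k q) = of k (p.comp q) := by
  simp [mulHom, mulPath]

theorem mulHom_ne {a b c d : V} (p : Quiver.Path a b) (q : Quiver.Path c d) (h : c ≠ b) :
    mulHom k V (of k p) (of k q) = 0 := by
  simp [mulHom, mulPath, h]

theorem induction {p : PathAlgebra k V → Prop} (x : PathAlgebra k V) (h0 : p 0)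
    (hadd : ∀ x y, p x → p y → p (x + y)) (hsmul : ∀ (c : k) x, p x → p (c • x))
    (hof : ∀ (a b : V) (q : Quiver.Path a b), p (of k q)) : p x := by
  refine Finsupp.induction_linear (motive := p) x h0 hadd fun q c => ?_
  have h : (Finsupp.single q c : QPath V →₀ k) = c • (of k q.path : PathAlgebra k V) := by
    refine Eq.trans ?_ (Finsupp.smul_single c q (1 : k)).symm
    rw [smul_eq_mul, mul_one]
  exact h ▸ hsmul c _ (hof _ _ _)

theorem mulHom_assoc (x y z : PathAlgebra k V) :
    mulHom k V (mulHom k V x y) z = mulHom k V x (mulHom k V y z) := by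
  induction x using induction with
  | h0 => simp
  | hadd x x' hx hx' => simp only [map_add, LinearMap.add_apply, hx, hx']
  | hsmul c x hx => simp only [map_smul, LinearMap.smul_apply, hx]
  | hof a b p =>
  induction y using induction with
  | h0 => simp
  | hadd x x' hx hx' => simp only [map_add, LinearMap.add_apply, hx, hx']
  | hsmul c x hx => simp only [map_smul, LinearMap.smul_apply, hx]
  | hof c d q =>
  induction z using induction with
  | h0 => simp
  | hadd x x' hx hx' => simp only [map_add, hx, hx']
  | hsmul c x hx => simp only [map_smul, hx]
  | hof e f r =>
  by_cases h : c = b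
  · subst h
    by_cases h' : e = d
    · subst h'
      simp only [mulHom_comp, Quiver.Path.comp_assoc]
    · rw [mulHom_comp, mulHom_ne _ _ h', mulHom_ne _ _ h', map_zero]
  · rw [mulHom_ne _ _ h, map_zero, LinearMap.zero_apply]
    by_cases h' : e = d
    · subst h'
      rw [mulHom_comp, mulHom_ne _ _ h]
    · rw [mulHom_ne _ _ h', map_zero]

variable [Fintype V]

theorem one_mulHom (x : PathAlgebra k V) :
    mulHom k V (∑ v : V, of k (Quiver.Path.nil : Quiver.Path v v)) x = x := by
  induction x using induction with
  | h0 => simp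
  | hadd x x' hx hx' => rw [map_add, hx, hx']
  | hsmul c x hx => rw [map_smul, hx]
  | hof a b p =>
    rw [map_sum, LinearMap.sum_apply, Finset.sum_eq_single a]
    · rw [mulHom_comp, Quiver.Path.nil_comp]
    · exact fun v _ hv => mulHom_ne _ _ hv.symm
    · simp

theorem mulHom_one (x : PathAlgebra k V) :
    mulHom k V x (∑ v : V, of k (Quiver.Path.nil : Quiver.Path v v)) = x := by
  induction x using induction with
  | h0 => simp
  | hadd x x' hx hx' => rw [map_add, LinearMap.add_apply, hx, hx']
  | hsmul c x hx => rw [map_smul, LinearMap.smul_apply, hx]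
  | hof a b p =>
    rw [map_sum, Finset.sum_eq_single b]
    · rw [mulHom_comp, Quiver.Path.comp_nil]
    · exact fun v _ hv => mulHom_ne _ _ hv
    · simp

instance : Ring (PathAlgebra k V) :=
  { (inferInstance : AddCommGroup (PathAlgebra k V)) with
    mul := fun x y => mulHom k V x y
    one := ∑ v : V, of k (Quiver.Path.nil : Quiver.Path v v)
    left_distrib := fun x y z => map_add _ y z
    right_distrib := fun x y z => LinearMap.congr_fun (map_add (mulHom k V) x y) z
    zero_mul := fun x => LinearMap.congr_fun (map_zero (mulHom k V)) x
    mul_zero := fun x => map_zero _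
    mul_assoc := mulHom_assoc
    one_mul := one_mulHom
    mul_one := mulHom_one }

instance : Algebra k (PathAlgebra k V) :=
  Algebra.ofModule
    (fun c x y => LinearMap.congr_fun (map_smul (mulHom k V) c x) y)
    (fun c x y => map_smul (mulHom k V x) c y)

theorem of_mul_of {a b c : V} (p : Quiver.Path a b) (q : Quiver.Path b c) :
    of k p * of k q = of k (p.comp q) := mulHom_comp p q

theorem of_mul_of_ne {a b c d : V} (p : Quiver.Path a b) (q : Quiver.Path c d) (h : c ≠ b) :
    of k p * of k q = 0 := mulHom_ne p q h

theorem one_def : (1 : PathAlgebra k V) = ∑ v : V, of k (Quiver.Path.nil : Quiver.Path v v) := rfl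

end PathAlgebra

end PathAlgebra

/-! ### Toupie algebras -/

section ToupieAlgebra

universe u v

/-- A toupie quiver with source `s` and sink `t`: it has no oriented cycles, `s` is the only vertex
at which no arrow ends, `t` is the only vertex at which no arrow starts, and every other vertex is
the source of exactly one arrow and the target of exactly one arrow. -/
structure IsToupie (V : Type u) [Quiver.{v} V] (s t : V) : Prop where
  acyclic : ∀ (x : V) (p : Quiver.Path x x), p.length = 0
  source : ∀ x : V, (¬∃ α : Arrow V, α.tgt = x) ↔ x = s
  sink : ∀ x : V, (¬∃ α : Arrow V, α.src = x) ↔ x = t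
  arrow_from : ∀ x : V, x ≠ s → x ≠ t → ∃! α : Arrow V, α.src = x
  arrow_to : ∀ x : V, x ≠ s → x ≠ t → ∃! α : Arrow V, α.tgt = x

variable {k : Type*} {V : Type u} [Field k] [Fintype V] [Quiver.{v} V]

open PathAlgebra

/-- Admissible ideals: `Jᴺ ⊆ I ⊆ J²` for some `N`, where `J` is the ideal generated by the arrows,
so that `Jⁿ` is spanned by the paths of length at least `n`. -/
def IsAdmissible (I : Ideal (PathAlgebra k V)) : Prop :=
  (∀ x ∈ I, x ∈ Submodule.span k
    {y | ∃ (a b : V) (p : Quiver.Path a b), 2 ≤ p.length ∧ y = of k p}) ∧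
  ∃ N : ℕ, ∀ (a b : V) (p : Quiver.Path a b), N ≤ p.length → of k p ∈ I

variable (I : Ideal (PathAlgebra k V)) [I.IsTwoSided]

/-- The class of a path in `A = k Q / I`. -/
def cls {a b : V} (p : Quiver.Path a b) : PathAlgebra k V ⧸ I := Ideal.Quotient.mk I (of k p)

/-- The idempotent `e_x` of `A`. -/
def idem (x : V) : PathAlgebra k V ⧸ I := cls I (Quiver.Path.nil : Quiver.Path x x)

/-- The class in `A` of an arrow. -/
def arr (α : Arrow V) : PathAlgebra k V ⧸ I := cls I α.hom.toPath

variable {s t : V}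

section Order

variable [LinearOrder (Quiver.Path s t)]

variable (s t) in
/-- The irreducible paths, with respect to an order `α⁽¹⁾ < α⁽²⁾ < ⋯` of the branches (the paths
from `s` to `t`): a branch is irreducible if its class is not a linear combination of the classes
of the branches that come after it; any other path is irreducible if its class is nonzero. -/
def IsIrr {a b : V} (p : Quiver.Path a b) : Prop :=
  cls I p ∉ Submodule.span k {x | ∃ q r : Quiver.Path s t,
    (⟨a, b, p⟩ : QPath V) = ⟨s, t, q⟩ ∧ q < r ∧ x = cls I r}

/-- The monomial relations: the paths in `I` that have no proper subpath in `I`. -/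
def IsMonRel {a b : V} (σ : Quiver.Path a b) : Prop :=
  of k σ ∈ I ∧ ∀ (x y : V) (p : Quiver.Path a x) (q : Quiver.Path x y) (r : Quiver.Path y b),
    σ = (p.comp q).comp r → 0 < p.length + r.length → of k q ∉ I

/-- The non-monomial relations `ρ = W - f`: here `W` is a branch that does not lie in `I`, and `f`
is a linear combination of irreducible branches that come after `W`. -/
def IsNonmonRel (W : Quiver.Path s t) (f : PathAlgebra k V) : Prop :=
  of k W ∉ I ∧
  f ∈ Submodule.span k {y | ∃ r : Quiver.Path s t, W < r ∧ IsIrr I s t r ∧ y = of k r} ∧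
  of k W - f ∈ I

variable (s t) in
/-- The minimal set `R = R_mon ∪ R_nomon` of generators of `I` that is attached to the order of
the branches. The non-monomial part corresponds to the reduced row echelon form of the linear
relations among the branches. -/
inductive Rel
  | mon {a b : V} (σ : Quiver.Path a b) (h : IsMonRel I σ) : Rel
  | nonmon (W : Quiver.Path s t) (f : PathAlgebra k V) (h : IsNonmonRel I W f) : Rel

namespace Rel

variable {I}

def src : Rel I s t → V
  | @mon _ _ _ _ _ _ _ _ _ _ a _ _ _ => a
  | nonmon _ _ _ => s

def tgt : Rel I s t → V
  | @mon _ _ _ _ _ _ _ _ _ _ _ b _ _ => b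
  | nonmon _ _ _ => t

/-- The relation as an element of the path algebra. -/
def val : Rel I s t → PathAlgebra k V
  | mon σ _ => of k σ
  | nonmon W f _ => of k W - f

end Rel

instance relEnds : Ends (Rel I s t) V := ⟨Rel.src, Rel.tgt⟩

end Order

/-! The beginning of the minimal resolution and of the `E`-reduced bar resolution. -/

open Classical in
theorem idem_mul_cls (v : V) {a b : V} (p : Quiver.Path a b) :
    idem I v * cls I p = if a = v then cls I p else 0 := by
  split_ifs with h
  · subst h
    refine (map_mul (Ideal.Quotient.mk I) _ _).symm.trans ?_
    rw [of_mul_of, Quiver.Path.nil_comp]; rfl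
  · refine (map_mul (Ideal.Quotient.mk I) _ _).symm.trans ?_
    rw [of_mul_of_ne _ _ h, map_zero]

open Classical in
theorem cls_mul_idem (v : V) {a b : V} (p : Quiver.Path a b) :
    cls I p * idem I v = if b = v then cls I p else 0 := by
  split_ifs with h
  · subst h
    refine (map_mul (Ideal.Quotient.mk I) _ _).symm.trans ?_
    rw [of_mul_of, Quiver.Path.comp_nil]; rfl
  · refine (map_mul (Ideal.Quotient.mk I) _ _).symm.trans ?_
    rw [of_mul_of_ne _ _ (Ne.symm h), map_zero]

/-- `A ⊗_E A`, written as `A ⊗_E E ⊗_E A`. -/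
abbrev P0 : Type _ := BT k (idem I) (V →₀ k)

/-- `A ⊗_E k Q₁ ⊗_E A`. -/
abbrev P1 : Type _ := BT k (idem I) (Arrow V →₀ k)

/-- The generator `1 ⊗ e_x ⊗ 1` of `A ⊗_E A`. -/
def genV (x : V) : P0 I := gen k (idem I) (Finsupp.single x (1 : k))

/-- The generator `1 ⊗ α ⊗ 1` of `A ⊗_E k Q₁ ⊗_E A`. -/
def genA (α : Arrow V) : P1 I := gen k (idem I) (Finsupp.single α (1 : k))

open Classical in
theorem lm_gen {X : Type*} [Ends X V] (v : V) (x : X) :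
    lm k (idem I v) • gen k (idem I) (Finsupp.single x (1 : k)) =
      if Ends.src x = v then gen k (idem I) (Finsupp.single x (1 : k)) else 0 := by
  rw [← gen_left, left_single]; split_ifs <;> simp

open Classical in
theorem rm_gen {X : Type*} [Ends X V] (v : V) (x : X) :
    rm k (idem I v) • gen k (idem I) (Finsupp.single x (1 : k)) =
      if Ends.tgt x = v then gen k (idem I) (Finsupp.single x (1 : k)) else 0 := by
  rw [← gen_right, right_single]; split_ifs <;> simp

/-- `d₀ : A ⊗_E k Q₁ ⊗_E A → A ⊗_E A`, `1 ⊗ α ⊗ 1 ↦ α ⊗ 1 - 1 ⊗ α`. -/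
def d0 : P1 I →ₗ[Env k (PathAlgebra k V ⧸ I)] P0 I :=
  lift <| onSymbols
    (fun α : Arrow V => lm k (arr I α) • genV I α.tgt - rm k (arr I α) • genV I α.src)
    (by
      intro v α
      rw [smul_sub, smul_smul, smul_smul, ← lm_mul, ← rm_lm, ← smul_smul (rm k (arr I α)), arr,
        idem_mul_cls, genV, genV, lm_gen]
      classical
      change _ = if α.src = v then _ else _
      change _ - _ • (if α.src = v then _ else _) = _
      split_ifs <;> simp)
    (by
      intro v α
      rw [smul_sub, smul_smul, smul_smul, ← rm_mul, rm_lm, ← smul_smul (lm k (arr I α)), arr,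
        cls_mul_idem, genV, genV, rm_gen]
      classical
      change _ = if α.tgt = v then _ else _
      change _ • (if α.tgt = v then _ else _) - _ = _
      split_ifs <;> simp)

/-- For a path `p`, the sum `∑ p₁ ⊗ α ⊗ p₃` over all factorizations `p = p₁ α p₃` with `α` an
arrow, by recursion on the path: the factorizations of `p β` are those of `p`, multiplied by `β`
on the right, and `p ⊗ β ⊗ 1`. -/
def factPath {a : V} : {b : V} → Quiver.Path a b → P1 I
  | _, .nil => 0
  | _, .cons (b := c) (c := b) p β =>
    rm k (arr I ⟨c, b, β⟩) • factPath p + lm k (cls I p) • genA I ⟨c, b, β⟩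

/-- The linear extension `k Q → A ⊗_E k Q₁ ⊗_E A` of `factPath`. -/
def fact : PathAlgebra k V →ₗ[k] P1 I := extend fun p => factPath I p.path

open Classical in
theorem lm_factPath (v : V) {a b : V} (p : Quiver.Path a b) :
    lm k (idem I v) • factPath I p = if a = v then factPath I p else 0 := by
  induction p with
  | nil => simp [factPath]
  | cons p β ih =>
    rw [factPath, smul_add, smul_smul, ← rm_lm, ← smul_smul, ih, smul_smul, ← lm_mul,
      idem_mul_cls]
    split_ifs <;> simp

open Classical in
theorem rm_factPath (v : V) {a b : V} (p : Quiver.Path a b) :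
    rm k (idem I v) • factPath I p = if b = v then factPath I p else 0 := by
  cases p with
  | nil => simp [factPath]
  | cons p β =>
    rw [factPath, smul_add, smul_smul, ← rm_mul, smul_smul, rm_lm, ← smul_smul, genA, rm_gen, arr,
      cls_mul_idem]
    change _ + _ • (if b = v then _ else _) = _
    split_ifs <;> simp

open Classical in
theorem lm_fact (v : V) {x y : V} (f : PathAlgebra k V)
    (hf : f ∈ Submodule.span k (Set.range fun r : Quiver.Path x y => of k r)) :
    lm k (idem I v) • fact I f = if x = v then fact I f else 0 := by
  induction hf using Submodule.span_induction with
  | zero => simp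
  | add f g _ _ hx hy => rw [map_add, smul_add, hx, hy]; split_ifs <;> simp
  | smul c f _ hx => rw [map_smul, smul_comm, hx]; split_ifs <;> simp
  | mem f hx =>
    obtain ⟨r, rfl⟩ := hx
    rw [fact, extend_of, lm_factPath]

open Classical in
theorem rm_fact (v : V) {x y : V} (f : PathAlgebra k V)
    (hf : f ∈ Submodule.span k (Set.range fun r : Quiver.Path x y => of k r)) :
    rm k (idem I v) • fact I f = if y = v then fact I f else 0 := by
  induction hf using Submodule.span_induction with
  | zero => simp
  | add f g _ _ hx hy => rw [map_add, smul_add, hx, hy]; split_ifs <;> simp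
  | smul c f _ hx => rw [map_smul, smul_comm, hx]; split_ifs <;> simp
  | mem f hx =>
    obtain ⟨r, rfl⟩ := hx
    rw [fact, extend_of, rm_factPath]

section Order

variable [LinearOrder (Quiver.Path s t)]

variable {I} in
theorem Rel.val_mem (r : Rel I s t) :
    r.val ∈ Submodule.span k (Set.range fun p : Quiver.Path r.src r.tgt => of k p) := by
  cases r with
  | mon σ h => exact Submodule.subset_span ⟨σ, rfl⟩
  | nonmon W f h =>
    refine Submodule.sub_mem _ (Submodule.subset_span ⟨W, rfl⟩) ?_
    refine Submodule.span_mono ?_ h.2.1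
    rintro _ ⟨p, _, _, rfl⟩
    exact ⟨p, rfl⟩

variable (s t) in
/-- `A ⊗_E k R ⊗_E A`. -/
abbrev P2 : Type _ := BT k (idem I) (Rel I s t →₀ k)

variable (s t) in
/-- `d₁ : A ⊗_E k R ⊗_E A → A ⊗_E k Q₁ ⊗_E A`, which sends `1 ⊗ r ⊗ 1` to the sum over all
factorizations of the paths that occur in `r`. -/
def d1 : P2 I s t →ₗ[Env k (PathAlgebra k V ⧸ I)] P1 I :=
  lift <| onSymbols (fun r : Rel I s t => fact I r.val)
    (fun v r => lm_fact I v r.val r.val_mem) (fun v r => rm_fact I v r.val r.val_mem)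

end Order

/-- The subspace `E = ⊕ k e_x` of `A`. -/
def subE : Submodule k (PathAlgebra k V ⧸ I) := Submodule.span k (Set.range (idem I))

/-- `Ā = A / E`. -/
abbrev Abar : Type _ := (PathAlgebra k V ⧸ I) ⧸ subE I

theorem idem_mul_subE (v : V) : subE I ≤ (subE I).comap (LinearMap.mulLeft k (idem I v)) := by
  refine Submodule.span_le.2 ?_
  rintro _ ⟨w, rfl⟩
  have h := idem_mul_cls I v (Quiver.Path.nil : Quiver.Path w w)
  change idem I v * idem I w ∈ subE I
  rw [idem, idem, ← idem, h]
  split_ifs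
  · exact Submodule.subset_span ⟨w, rfl⟩
  · exact Submodule.zero_mem _

theorem subE_mul_idem (v : V) : subE I ≤ (subE I).comap (LinearMap.mulRight k (idem I v)) := by
  refine Submodule.span_le.2 ?_
  rintro _ ⟨w, rfl⟩
  have h := cls_mul_idem I v (Quiver.Path.nil : Quiver.Path w w)
  change idem I w * idem I v ∈ subE I
  rw [idem, h]
  split_ifs
  · exact Submodule.subset_span ⟨w, rfl⟩
  · exact Submodule.zero_mem _

/-- The `E`-bimodule structure of `Ā`: `e_v ā` is the class of `e_v a` and `ā e_v` that of
`a e_v`. -/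
instance abarAction : VertexAction k V (Abar I) where
  left v := (subE I).mapQ (subE I) (LinearMap.mulLeft k (idem I v)) (idem_mul_subE I v)
  right v := (subE I).mapQ (subE I) (LinearMap.mulRight k (idem I v)) (subE_mul_idem I v)

/-- The class `ā` in `Ā` of `a`. -/
def bar : (PathAlgebra k V ⧸ I) →ₗ[k] Abar I := (subE I).mkQ

theorem left_bar (v : V) (a : PathAlgebra k V ⧸ I) :
    VertexAction.left (k := k) v (bar I a) = bar I (idem I v * a) := rfl

theorem right_bar (v : V) (a : PathAlgebra k V ⧸ I) :
    VertexAction.right (k := k) v (bar I a) = bar I (a * idem I v) := rfl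

/-- The term `A ⊗_E Ā ⊗_E A` of the `E`-reduced bar resolution. -/
abbrev Bar1 : Type _ := BT k (idem I) (Abar I)

/-- The generator `1 ⊗ ā ⊗ 1` of `A ⊗_E Ā ⊗_E A`. -/
def genB (a : PathAlgebra k V ⧸ I) : Bar1 I := gen k (idem I) (bar I a)

/-- The element `1 ⊗ 1` of `A ⊗_E A`. -/
def oneP0 : P0 I := ∑ v : V, genV I v

theorem lm_oneP0 (v : V) : lm k (idem I v) • oneP0 I = rm k (idem I v) • oneP0 I := by
  simp only [oneP0, Finset.smul_sum, genV, lm_gen, rm_gen]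
  rfl

/-- The map `a ↦ a ⊗ 1 - 1 ⊗ a` from `A` to `A ⊗_E A`. -/
def delta0Aux : (PathAlgebra k V ⧸ I) →ₗ[k] P0 I where
  toFun a := lm k a • oneP0 I - rm k a • oneP0 I
  map_add' a b := by simp only [map_add, add_smul]; abel
  map_smul' c a := by simp only [map_smul, smul_assoc, smul_sub, RingHom.id_apply]

/-- The differential `δ₀ : A ⊗_E Ā ⊗_E A → A ⊗_E A`, `1 ⊗ ā ⊗ 1 ↦ a ⊗ 1 - 1 ⊗ a`, of the
`E`-reduced bar resolution. -/
def delta0 : Bar1 I →ₗ[Env k (PathAlgebra k V ⧸ I)] P0 I :=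
  lift (M := Abar I) (e := idem I) <| HomE.ofHom
    ((subE I).liftQ (delta0Aux I) <| Submodule.span_le.2 <| by
      rintro _ ⟨v, rfl⟩
      exact sub_eq_zero.2 (lm_oneP0 I v)) <| by
    intro v m
    obtain ⟨a, rfl⟩ := (subE I).mkQ_surjective m
    constructor
    · change delta0Aux I (idem I v * a) = _ • delta0Aux I a
      simp only [delta0Aux, LinearMap.coe_mk, AddHom.coe_mk, smul_sub, smul_smul, ← lm_mul,
        ← rm_lm, rm_mul]
      simp only [mul_smul, lm_oneP0]
    · change delta0Aux I (a * idem I v) = _ • delta0Aux I a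
      simp only [delta0Aux, LinearMap.coe_mk, AddHom.coe_mk, smul_sub, smul_smul, ← rm_mul,
        rm_lm, lm_mul]
      simp only [mul_smul, lm_oneP0]

/-- The comparison map `φ₁ : A ⊗_E k Q₁ ⊗_E A → A ⊗_E Ā ⊗_E A`, `1 ⊗ α ⊗ 1 ↦ 1 ⊗ ᾱ ⊗ 1`. -/
def phi1 : P1 I →ₗ[Env k (PathAlgebra k V ⧸ I)] Bar1 I :=
  lift <| onSymbols (fun α : Arrow V => genB I (arr I α))
    (by
      intro v α
      rw [genB, ← gen_left, left_bar, arr, idem_mul_cls]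
      classical
      change _ = if α.src = v then _ else _
      split_ifs <;> simp)
    (by
      intro v α
      rw [genB, ← gen_right, right_bar, arr, cls_mul_idem]
      classical
      change _ = if α.tgt = v then _ else _
      split_ifs <;> simp)

variable (s t) [LinearOrder (Quiver.Path s t)] in
/-- The bimodule map `η : A ⊗_E Ā ⊗_E A → A ⊗_E k Q₁ ⊗_E A` is the comparison map `η₁`:
`1 ⊗ b̄ ⊗ 1 ↦ ∑ b₁ ⊗ α ⊗ b₃`, the sum over the factorizations `b = b₁ α b₃` with `α` an arrow,
for each irreducible path `b`. -/
def IsEta1 (η : Bar1 I →ₗ[Env k (PathAlgebra k V ⧸ I)] P1 I) : Prop :=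
  ∀ (a b : V) (p : Quiver.Path a b), IsIrr I s t p → η (genB I (cls I p)) = factPath I p

/-! Cochains. -/

/-- `Hom_{Eᵉ}(E, A)`. -/
abbrev C0 : Type _ := HomE k (idem I) (V →₀ k) (PathAlgebra k V ⧸ I)

/-- `Hom_{Eᵉ}(k Q₁, A)`. -/
abbrev C1 : Type _ := HomE k (idem I) (Arrow V →₀ k) (PathAlgebra k V ⧸ I)

variable (s t) [LinearOrder (Quiver.Path s t)] in
/-- `Hom_{Eᵉ}(k R, A)`. -/
abbrev C2 : Type _ := HomE k (idem I) (Rel I s t →₀ k) (PathAlgebra k V ⧸ I)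

/-- `Hom_{Eᵉ}(Ā, A)`. -/
abbrev CBar1 : Type _ := HomE k (idem I) (Abar I) (PathAlgebra k V ⧸ I)

/-- `D₀ : Hom_{Eᵉ}(E, A) → Hom_{Eᵉ}(k Q₁, A)`. -/
def D0 : C0 I →ₗ[k] C1 I := pull (d0 I)

variable (s t) [LinearOrder (Quiver.Path s t)] in
/-- `D₁ : Hom_{Eᵉ}(k Q₁, A) → Hom_{Eᵉ}(k R, A)`. -/
def D1 : C1 I →ₗ[k] C2 I s t := pull (d1 I s t)

variable (s t) [LinearOrder (Quiver.Path s t)] in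
/-- The first cohomology `Ker D₁ / Im D₀` of the complex obtained from the minimal resolution. -/
abbrev H1min : Type _ :=
  LinearMap.ker (D1 I s t) ⧸ (LinearMap.range (D0 I)).comap (LinearMap.ker (D1 I s t)).subtype

/-- The reduced composition `f ∘ g : ā ↦ f(\overline{g(ā)})` on `Hom_{Eᵉ}(Ā, A)`. -/
def circ : CBar1 I →ₗ[k] CBar1 I →ₗ[k] CBar1 I :=
  LinearMap.mk₂ k (fun f g => HomE.ofHom (HomE.toHom f ∘ₗ bar I ∘ₗ HomE.toHom g) fun v m => by
      simp only [LinearMap.comp_apply, HomE.toHom_left, HomE.toHom_right, lm_smul, rm_smul]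
      rw [← left_bar, ← right_bar]
      simp only [HomE.toHom_left, HomE.toHom_right, lm_smul, rm_smul, and_self])
    (fun _ _ _ => rfl) (fun _ _ _ => rfl)
    (fun f g g' => HomE.ext fun x => by simp)
    (fun c f g => HomE.ext fun x => by simp)

/-- The reduced Gerstenhaber bracket `[f, g] = f ∘ g - g ∘ f` on `Hom_{Eᵉ}(Ā, A)`. -/
def redBracket : CBar1 I →ₗ[k] CBar1 I →ₗ[k] CBar1 I := circ I - (circ I).flip

/-- The inclusion `Hom_{Eᵉ}(Ā, A) → Hom_k(A, A)` of the reduced Hochschild `1`-cochains. -/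
def infl : CBar1 I →ₗ[k] Module.End k (PathAlgebra k V ⧸ I) :=
  LinearMap.lcomp k (PathAlgebra k V ⧸ I) (bar I) ∘ₗ HomE.toHom

/-- The bracket `[F, G] = φ₁*[η₁*(F), η₁*(G)]` on `Hom_{Eᵉ}(k Q₁, A)`, obtained from the reduced
Gerstenhaber bracket by means of the comparison maps. -/
def minBracket (η : Bar1 I →ₗ[Env k (PathAlgebra k V ⧸ I)] P1 I) : C1 I →ₗ[k] C1 I →ₗ[k] C1 I :=
  ((redBracket I).compl₁₂ (pull η) (pull η)).compr₂ (pull (phi1 I))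

open Classical in
/-- The linear map `k Q₁ → A` that sends the arrow `α` to `x` and every other arrow to `0`. -/
def symb (α : Arrow V) (x : PathAlgebra k V ⧸ I) : (Arrow V →₀ k) →ₗ[k] (PathAlgebra k V ⧸ I) :=
  Finsupp.linearCombination k fun γ => if γ = α then x else 0

/-- The element `α ‖ h` of `Hom_{Eᵉ}(k Q₁, A)`, for a path `h` that is parallel to the arrow `α`:
it sends `α` to `h` and every other arrow to `0`. -/
def par (α : Arrow V) (h : Quiver.Path α.src α.tgt) : C1 I :=
  HomE.ofHom (symb I α (cls I h)) <| by
    classical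
    refine (onSymbols (fun γ => if γ = α then cls I h else 0) ?_ ?_).2
    · intro v γ
      by_cases hγ : γ = α
      · subst hγ
        simp only [if_true, lm_smul, idem_mul_cls]; rfl
      · simp [hγ]
    · intro v γ
      by_cases hγ : γ = α
      · subst hγ
        simp only [if_true, rm_smul, cls_mul_idem]; rfl
      · simp [hγ]

open Classical in
variable (k) in
/-- `b^{α ‖ h}` for a path `b`: the sum of all paths obtained by replacing an occurrence of the
arrow `α` in `b` by the parallel path `h`, by recursion on `b`; it is `0` if `α` does not occur. -/
def replace (α : Arrow V) (h : Quiver.Path α.src α.tgt) {a : V} :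
    {b : V} → Quiver.Path a b → PathAlgebra k V
  | _, .nil => 0
  | _, .cons (b := c) (c := b) p β =>
    replace α h p * of k β.toPath + if (⟨c, b, β⟩ : Arrow V) = α then of k p * of k h else 0

/-- The class in `A` of `b^{α ‖ h}`. -/
def replaced (α : Arrow V) (h : Quiver.Path α.src α.tgt) {a b : V} (p : Quiver.Path a b) :
    PathAlgebra k V ⧸ I :=
  Ideal.Quotient.mk I (replace k α h p)

end ToupieAlgebra

end Toupie

end

noncomputable section

namespace Toupie

section Proof

universe u v

variable {k : Type*} {V : Type u} [Field k] [Fintype V] [Quiver.{v} V]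

open PathAlgebra

variable (I : Ideal (PathAlgebra k V)) [I.IsTwoSided]

/-! Everything reduces to derivations. A cochain `F` on the arrows extends in exactly one way to a
derivation from `k Q` to `A`, over the quotient map, that kills the vertices. It is `derivOf F`, the
composite of the sum over factorizations `fact` with the bimodule map of `F`; the Leibniz rule is
`fact_mul`. The value of `D₁ F` at a relation is `derivOf F` of that relation, so the kernel of `D₁`
consists of the `F` whose derivation kills the chosen relations (`mem_ker_D1`).

By definition of `η₁`, the cochain `η₁* F` agrees with `derivOf F` on irreducible paths
(`infl_pull_irr`). Arrows are irreducible because the ideal is admissible, so `φ₁* η₁*` is the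
identity, and the bracket of `F` and `G` at an arrow `γ` is `(η₁* F)(G γ) - (η₁* G)(F γ)`. For `α ‖
h` and `β ‖ b` the inner values are zero or irreducible paths, on which the derivation of `α ‖ h`
replaces `α` by `h`. This gives the formula of part 1, with no cocycle condition.

For a cocycle, `η₁* F` agrees with `derivOf F` on every path (`infl_pull_toAlg`), hence is a
derivation of `A`. The combinatorial input is `isIrr_or`: a path is irreducible, or lies in `I`, or
leads a non-monomial relation; this is Gaussian elimination among the branches. The toupie shape
enters through `IsToupie.path_eq`: parallel paths that are not branches coincide. Therefore
irreducible paths form a basis of `A`, on which `η₁` can be defined.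

Conversely, every derivation of `A` kills the vertices after an inner correction. It is then a
reduced cochain determined by its values on arrows, so `η₁*` and `φ₁*` are inverse on cocycles.
Inner derivations that kill the vertices come from elements commuting with the vertices, that is,
from 0-cochains. Both brackets are commutators of derivations. -/

/-! ### Classes of paths and the Leibniz rule for factorizations -/

/-- The quotient map `k Q → A` as a linear map. -/
def toAlg : PathAlgebra k V →ₗ[k] PathAlgebra k V ⧸ I := (Ideal.Quotient.mkₐ k I).toLinearMap

theorem toAlg_of {a b : V} (p : Quiver.Path a b) : toAlg I (of k p) = cls I p := rfl

theorem toAlg_mul (x y : PathAlgebra k V) : toAlg I (x * y) = toAlg I x * toAlg I y := rfl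

theorem toAlg_eq_zero {x : PathAlgebra k V} : toAlg I x = 0 ↔ x ∈ I := Ideal.Quotient.eq_zero_iff_mem

theorem toAlg_surjective : Function.Surjective (toAlg I) := Ideal.Quotient.mk_surjective

theorem cls_comp {a b c : V} (p : Quiver.Path a b) (q : Quiver.Path b c) :
    cls I (p.comp q) = cls I p * cls I q := by
  rw [← toAlg_of, ← of_mul_of, toAlg_mul]; rfl

theorem cls_cons {a b c : V} (p : Quiver.Path a b) (β : b ⟶ c) :
    cls I (p.cons β) = cls I p * arr I ⟨b, c, β⟩ := cls_comp I p β.toPath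

theorem cls_mul_of_ne {a b c d : V} (p : Quiver.Path a b) (q : Quiver.Path c d) (h : c ≠ b) :
    cls I p * cls I q = 0 := by
  rw [← toAlg_of, ← toAlg_of, ← toAlg_mul, of_mul_of_ne p q h, map_zero]

theorem one_eq_sum_idem : (1 : PathAlgebra k V ⧸ I) = ∑ v : V, idem I v := by
  have : toAlg I (1 : PathAlgebra k V) = ∑ v : V, idem I v := by
    rw [one_def, map_sum]; rfl
  exact this

open Classical in
theorem idem_mul_idem (v w : V) : idem I v * idem I w = if w = v then idem I v else 0 := by
  refine (idem_mul_cls I v (Quiver.Path.nil : Quiver.Path w w)).trans ?_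
  split_ifs with h
  · subst h; rfl
  · rfl

/-- The distinguished arrow of a factorization of the composite lies either in `p` or in `q`. -/
theorem factPath_comp {a b c : V} (p : Quiver.Path a b) (q : Quiver.Path b c) :
    factPath I (p.comp q) = rm k (cls I q) • factPath I p + lm k (cls I p) • factPath I q := by
  induction q with
  | nil =>
    have := rm_factPath I b p
    rw [if_pos rfl] at this
    rw [Quiver.Path.comp_nil, factPath, smul_zero, add_zero]
    exact this.symm
  | cons q β ih =>
    rw [Quiver.Path.comp_cons, factPath, ih, factPath, cls_cons, cls_comp, rm_mul, lm_mul, smul_add,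
      smul_add, smul_smul, smul_smul, smul_smul, smul_smul, rm_lm, add_assoc]

theorem factPath_toPath (α : Arrow V) : factPath I α.hom.toPath = genA I α := by
  have h := lm_gen (k := k) I α.src α
  replace h := h.trans (if_pos rfl)
  change rm k _ • (0 : P1 I) + lm k (idem I α.src) • genA I α = _
  rw [smul_zero, zero_add]
  exact h

theorem fact_of {a b : V} (p : Quiver.Path a b) : fact I (of k p) = factPath I p := extend_of _ _

theorem fact_mul (x y : PathAlgebra k V) :
    fact I (x * y) = rm k (toAlg I y) • fact I x + lm k (toAlg I x) • fact I y := by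
  induction x using PathAlgebra.induction with
  | h0 => simp
  | hadd x x' hx hx' => simp only [add_mul, map_add, hx, hx', smul_add, add_smul]; abel
  | hsmul c x hx =>
    rw [smul_mul_assoc, map_smul, hx, map_smul, map_smul, map_smul, smul_add, smul_assoc,
      smul_comm c (rm k _)]
  | hof a b p =>
  induction y using PathAlgebra.induction with
  | h0 => simp
  | hadd x x' hx hx' => simp only [mul_add, map_add, hx, hx', smul_add, add_smul]; abel
  | hsmul c x hx =>
    rw [mul_smul_comm, map_smul, hx, map_smul, map_smul, map_smul, smul_add, smul_assoc,
      smul_comm c (lm k _)]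
  | hof c d q =>
  rw [toAlg_of, toAlg_of, fact_of, fact_of]
  by_cases h : c = b
  · subst h
    rw [of_mul_of, fact_of, factPath_comp]
  -- The paths do not compose: inserting the idempotents at the end of `p` and at the start of `q`
  -- shows that both terms on the right vanish.
  · have h1 := rm_factPath I b p
    have h2 := lm_factPath I c q
    rw [if_pos rfl] at h1 h2
    rw [of_mul_of_ne p q h, map_zero, ← h1, ← h2, smul_smul, smul_smul, ← rm_mul, ← lm_mul,
      idem, idem, cls_mul_of_ne I _ q h, cls_mul_of_ne I p _ h]
    simp

/-! ### The differentials of the two resolutions on generators -/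

theorem delta0Aux_mul (a b : PathAlgebra k V ⧸ I) :
    delta0Aux I (a * b) = rm k b • delta0Aux I a + lm k a • delta0Aux I b := by
  simp only [delta0Aux, LinearMap.coe_mk, AddHom.coe_mk, smul_sub, smul_smul, lm_mul, rm_mul, rm_lm]
  abel

theorem delta0Aux_idem (v : V) : delta0Aux I (idem I v) = 0 := sub_eq_zero.2 (lm_oneP0 I v)

/-- Of the summands of `1 ⊗ 1`, only the one at the end of `p` survives. Together with the mirror
statement this identifies the formula for `d₀` at an arrow with that for `δ₀`. -/
theorem lm_cls_oneP0 {a b : V} (p : Quiver.Path a b) :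
    lm k (cls I p) • oneP0 I = lm k (cls I p) • genV I b := by
  classical
  have h := cls_mul_idem I b p
  rw [if_pos rfl] at h
  conv_lhs => rw [← h, lm_mul, mul_smul]
  rw [oneP0, Finset.smul_sum]
  congr 1
  simp only [genV, lm_gen]
  exact (Finset.sum_ite_eq' Finset.univ b _).trans (if_pos (Finset.mem_univ _))

theorem rm_cls_oneP0 {a b : V} (p : Quiver.Path a b) :
    rm k (cls I p) • oneP0 I = rm k (cls I p) • genV I a := by
  classical
  have h := idem_mul_cls I a p
  rw [if_pos rfl] at h
  conv_lhs => rw [← h, rm_mul, mul_smul]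
  rw [oneP0, Finset.smul_sum]
  congr 1
  simp only [genV, rm_gen]
  exact (Finset.sum_ite_eq' Finset.univ a _).trans (if_pos (Finset.mem_univ _))

theorem d0_genA (α : Arrow V) : d0 I (genA I α) = delta0Aux I (arr I α) := by
  refine (lift_gen _ _).trans ?_
  refine (Finsupp.linearCombination_single k (1 : k) α).trans ?_
  rw [one_smul]
  change _ = lm k (cls I _) • oneP0 I - rm k (cls I _) • oneP0 I
  rw [lm_cls_oneP0, rm_cls_oneP0]; rfl

/-- The image of the sum over factorizations telescopes: both sides obey the same Leibniz rule,
vanish on trivial paths and agree on arrows. -/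
theorem d0_factPath {a b : V} (p : Quiver.Path a b) :
    d0 I (factPath I p) = delta0Aux I (cls I p) := by
  induction p with
  | nil => exact (map_zero _).trans (delta0Aux_idem I a).symm
  | cons p β ih => rw [factPath, map_add, map_smul, map_smul, ih, d0_genA, cls_cons, delta0Aux_mul]

theorem d0_fact (x : PathAlgebra k V) : d0 I (fact I x) = delta0Aux I (toAlg I x) := by
  have : (d0 I).restrictScalars k ∘ₗ fact I = delta0Aux I ∘ₗ toAlg I :=
    hom_ext fun a b p => by
      change d0 I (fact I (of k p)) = _
      rw [fact_of, d0_factPath]; rfl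
  exact LinearMap.congr_fun this x

theorem delta0_genB (a : PathAlgebra k V ⧸ I) : delta0 I (genB I a) = delta0Aux I a :=
  lift_gen _ _

theorem phi1_genA (α : Arrow V) : phi1 I (genA I α) = genB I (arr I α) := by
  refine (lift_gen _ _).trans ?_
  exact (Finsupp.linearCombination_single k (1 : k) α).trans (one_smul k _)

/-- Bimodule maps out of `A ⊗_E M ⊗_E A` are determined by their values on generators. -/
theorem bt_hom_ext {W A M P : Type*} [Ring A] [Algebra k A] {e : W → A} [AddCommGroup M]
    [Module k M] [VertexAction k W M] [AddCommGroup P] [Module k P] [Module (Env k A) P]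
    [IsScalarTower k (Env k A) P] {f g : BT k e M →ₗ[Env k A] P}
    (h : ∀ m, f (gen k e m) = g (gen k e m)) : f = g :=
  homF.injective (HomE.ext h)

/-- Bimodule maps out of `A ⊗_E k X ⊗_E A` are determined by their values on the symbols. -/
theorem bt_symbol_hom_ext {W A X P : Type*} [Ring A] [Algebra k A] {e : W → A} [Ends X W]
    [AddCommGroup P] [Module k P] [Module (Env k A) P]
    [IsScalarTower k (Env k A) P] {f g : BT k e (X →₀ k) →ₗ[Env k A] P}
    (h : ∀ x : X, f (gen k e (Finsupp.single x 1)) = g (gen k e (Finsupp.single x 1))) : f = g := by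
  refine bt_hom_ext fun m => ?_
  have : f.restrictScalars k ∘ₗ gen k e = g.restrictScalars k ∘ₗ gen k e :=
    Finsupp.lhom_ext' fun x => LinearMap.ext_ring (h x)
  exact LinearMap.congr_fun this m

theorem delta0_comp_phi1 : delta0 I ∘ₗ phi1 I = d0 I :=
  bt_symbol_hom_ext fun α => by
    change delta0 I (phi1 I (genA I α)) = d0 I (genA I α)
    rw [phi1_genA, delta0_genB, d0_genA]

theorem pull_apply {W A M N : Type*} [Ring A] [Algebra k A] {e : W → A} [AddCommGroup M]
    [Module k M] [VertexAction k W M] [AddCommGroup N] [Module k N] [VertexAction k W N]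
    (d : BT k e M →ₗ[Env k A] BT k e N) (f : HomE k e N A) (m : M) :
    HomE.toHom (pull d f) m = lift f (d (gen k e m)) := rfl

/-! ### Cochains as derivations -/

section Cochains

variable {I}

theorem lift_genA (F : C1 I) (α : Arrow V) :
    lift F (genA I α) = HomE.toHom F (Finsupp.single α 1) := lift_gen _ _

theorem C1_ext {F G : C1 I}
    (h : ∀ α : Arrow V, HomE.toHom F (Finsupp.single α 1) = HomE.toHom G (Finsupp.single α 1)) :
    F = G := by
  have : HomE.toHom F = HomE.toHom G := Finsupp.lhom_ext' fun x => LinearMap.ext_ring (h x)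
  exact HomE.ext fun m => LinearMap.congr_fun this m

theorem C1_idem_left (F : C1 I) (α : Arrow V) :
    idem I α.src * HomE.toHom F (Finsupp.single α 1) = HomE.toHom F (Finsupp.single α 1) := by
  rw [← lm_smul (k := k), ← HomE.toHom_left, left_single]
  exact congrArg _ (if_pos rfl)

theorem C1_idem_right (F : C1 I) (α : Arrow V) :
    HomE.toHom F (Finsupp.single α 1) * idem I α.tgt = HomE.toHom F (Finsupp.single α 1) := by
  rw [← rm_smul (k := k), ← HomE.toHom_right, right_single]
  exact congrArg _ (if_pos rfl)

/-- The derivation `k Q → A` that extends a cochain `F : k Q₁ → A`: a path `p` is sent to the sum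
of `p₁ F(α) p₃` over all factorizations `p = p₁ α p₃` with `α` an arrow. -/
def derivOf (F : C1 I) : PathAlgebra k V →ₗ[k] PathAlgebra k V ⧸ I :=
  (lift F).restrictScalars k ∘ₗ fact I

theorem derivOf_apply (F : C1 I) (x : PathAlgebra k V) : derivOf F x = lift F (fact I x) := rfl

theorem derivOf_of (F : C1 I) {a b : V} (p : Quiver.Path a b) :
    derivOf F (of k p) = lift F (factPath I p) := by
  rw [derivOf_apply, fact_of]

theorem derivOf_mul (F : C1 I) (x y : PathAlgebra k V) :
    derivOf F (x * y) = toAlg I x * derivOf F y + derivOf F x * toAlg I y := by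
  rw [derivOf_apply, fact_mul, map_add, map_smul, map_smul, lm_smul, rm_smul, add_comm]; rfl

/-- A derivation of `A` that vanishes on the vertices is determined by its values on the arrows. -/
theorem derivOf_eq (D : Module.End k (PathAlgebra k V ⧸ I))
    (hD : ∀ x y, D (x * y) = x * D y + D x * y) (hE : ∀ v, D (idem I v) = 0) (F : C1 I)
    (hF : ∀ α, HomE.toHom F (Finsupp.single α 1) = D (arr I α)) (x : PathAlgebra k V) :
    derivOf F x = D (toAlg I x) := by
  have : derivOf F = D ∘ₗ toAlg I := hom_ext fun a b p => by
    rw [derivOf_of, LinearMap.comp_apply, toAlg_of]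
    induction p with
    | nil => exact (map_zero _).trans (hE a).symm
    | cons p β ih =>
      rw [factPath, map_add, map_smul, map_smul, ih, cls_cons, hD, lm_smul, rm_smul, lift_genA, hF,
        add_comm]
  exact LinearMap.congr_fun this x

theorem infl_apply (f : CBar1 I) (a : PathAlgebra k V ⧸ I) :
    infl I f a = HomE.toHom f (bar I a) := rfl

theorem infl_idem (f : CBar1 I) (v : V) : infl I f (idem I v) = 0 := by
  have : bar I (idem I v) = 0 :=
    (Submodule.Quotient.mk_eq_zero _).2 (Submodule.subset_span ⟨v, rfl⟩)
  rw [infl_apply, this, map_zero]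

theorem infl_injective : Function.Injective (infl I) := fun f g h => HomE.ext fun m => by
  obtain ⟨a, rfl⟩ := (subE I).mkQ_surjective m
  exact LinearMap.congr_fun h a

theorem pull_phi1_single (f : CBar1 I) (α : Arrow V) :
    HomE.toHom (pull (phi1 I) f) (Finsupp.single α 1) = infl I f (arr I α) := by
  refine (pull_apply _ _ _).trans ?_
  change lift f (phi1 I (genA I α)) = _
  rw [phi1_genA]
  exact lift_gen _ _

theorem infl_pull {η : Bar1 I →ₗ[Env k (PathAlgebra k V ⧸ I)] P1 I} (F : C1 I)
    (a : PathAlgebra k V ⧸ I) : infl I (pull η F) a = lift F (η (genB I a)) := rfl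

theorem infl_redBracket (f g : CBar1 I) :
    infl I (redBracket I f g) = infl I f * infl I g - infl I g * infl I f := rfl

end Cochains

/-! ### Paths in a toupie quiver -/

section Quivers

variable {W : Type u} [Quiver.{v} W] {s t : W}

theorem IsToupie.ne_source (hQ : IsToupie W s t) {x y : W} (e : x ⟶ y) : y ≠ s := fun h =>
  (hQ.source y).2 h ⟨⟨x, y, e⟩, rfl⟩

theorem IsToupie.ne_sink (hQ : IsToupie W s t) {x y : W} (e : x ⟶ y) : x ≠ t := fun h =>
  (hQ.sink x).2 h ⟨⟨x, y, e⟩, rfl⟩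

/-- Read backwards from the end, a path has no choice: a vertex that is neither source nor sink has
one incoming arrow, and a vertex at which an arrow starts is never the sink. Acyclicity excludes
that one path stops earlier than the other. -/
theorem IsToupie.path_eq_of_tgt_ne (hQ : IsToupie W s t) {x y : W} (hy : y ≠ t)
    (p q : Quiver.Path x y) : p = q := by
  induction p with
  | nil => exact (Quiver.Path.eq_nil_of_length_zero q (hQ.acyclic _ q)).symm
  | cons p e ih =>
    cases q with
    | nil => exact Quiver.Path.eq_nil_of_length_zero _ (hQ.acyclic _ _)
    | cons q e' =>
      obtain ⟨_, _, h⟩ := hQ.arrow_to _ (hQ.ne_source e) hy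
      have h1 := (h ⟨_, _, e⟩ rfl).trans (h ⟨_, _, e'⟩ rfl).symm
      cases h1
      rw [ih (hQ.ne_sink e) q]

/-- The mirror argument, following the unique outgoing arrows. Paths are built up at their end, so
the induction is on the length and splits off the first arrow. -/
theorem IsToupie.path_eq_of_src_ne (hQ : IsToupie W s t) (n : ℕ) {x y : W} (hx : x ≠ s)
    (p q : Quiver.Path x y) (hp : p.length = n) : p = q := by
  induction n generalizing x with
  | zero =>
    obtain rfl := p.eq_of_length_zero hp
    rw [p.eq_nil_of_length_zero hp, q.eq_nil_of_length_zero (hQ.acyclic _ q)]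
  | succ n ih =>
    obtain ⟨c, e, p, hp', rfl⟩ := p.eq_toPath_comp_of_length_eq_succ hp
    cases hq : q.length with
    | zero =>
      obtain rfl := q.eq_of_length_zero hq
      rw [hQ.acyclic _ _] at hp
      omega
    | succ m =>
      obtain ⟨c', e', q, hq', rfl⟩ := q.eq_toPath_comp_of_length_eq_succ hq
      obtain ⟨_, _, h⟩ := hQ.arrow_from _ hx (hQ.ne_sink e)
      have h1 := (h ⟨_, _, e⟩ rfl).trans (h ⟨_, _, e'⟩ rfl).symm
      cases h1
      rw [ih (hQ.ne_source e) p q hp']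

theorem IsToupie.path_eq (hQ : IsToupie W s t) {x y : W} (h : ¬(x = s ∧ y = t))
    (p q : Quiver.Path x y) : p = q := by
  by_cases hy : y = t
  · exact hQ.path_eq_of_src_ne _ (fun hx => h ⟨hx, hy⟩) p q rfl
  · exact hQ.path_eq_of_tgt_ne hy p q

theorem finite_arrow [Finite W] [∀ x y : W, Finite (x ⟶ y)] : Finite (Arrow W) :=
  Finite.of_injective (β := Σ x : W, Σ y : W, x ⟶ y) (fun α => ⟨α.src, α.tgt, α.hom⟩) <| by
    rintro ⟨x, y, e⟩ ⟨x', y', e'⟩ h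
    cases h
    rfl

/-- The last arrow of a path, if there is one. -/
def lastArrow {x : W} : {y : W} → Quiver.Path x y → Option (Arrow W)
  | _, .nil => none
  | _, .cons (b := c) (c := b) _ β => some ⟨c, b, β⟩

/-- The last arrow starts away from the sink, so the part of the path before it is determined. This
bounds the number of branches by the number of arrows. -/
theorem IsToupie.lastArrow_injective (hQ : IsToupie W s t) (x y : W) :
    Function.Injective (lastArrow : Quiver.Path x y → Option (Arrow W)) := by
  intro p q h
  cases p with
  | nil => exact (Quiver.Path.eq_nil_of_length_zero q (hQ.acyclic _ q)).symm
  | cons p e =>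
    cases q with
    | nil => exact Quiver.Path.eq_nil_of_length_zero _ (hQ.acyclic _ _)
    | cons q e' =>
      cases Option.some.inj h
      rw [hQ.path_eq_of_tgt_ne (hQ.ne_sink e) p q]

theorem IsToupie.finite_path (hQ : IsToupie W s t) [Finite W] [∀ x y : W, Finite (x ⟶ y)]
    (x y : W) : Finite (Quiver.Path x y) :=
  have := finite_arrow (W := W)
  Finite.of_injective _ (hQ.lastArrow_injective x y)

end Quivers

-- Since `I` is contained in the span of the paths of length at least two, its elements have no
-- component along shorter paths.
open Classical in
theorem IsAdmissible.coeff_eq_zero {I : Ideal (PathAlgebra k V)} (hI : IsAdmissible I)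
    {x : PathAlgebra k V} (hx : x ∈ I) (p : QPath V) (hp : p.path.length ≤ 1) :
    extend (Pi.single p (1 : k)) x = 0 := by
  have h : Submodule.span k {y | ∃ (a b : V) (p : Quiver.Path a b), 2 ≤ p.length ∧ y = of k p} ≤
      LinearMap.ker (extend (Pi.single p (1 : k))) := by
    refine Submodule.span_le.2 ?_
    rintro _ ⟨a, b, q, hq, rfl⟩
    refine (extend_of _ _).trans (Pi.single_eq_of_ne ?_ _)
    rintro rfl
    exact absurd hq (by simpa using hp)
  exact h (hI.1 x hx)

/-! ### Irreducible paths form a basis -/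

section Irreducible

variable {s t : V} [LinearOrder (Quiver.Path s t)] {I}

theorem isIrr_branch_iff (W : Quiver.Path s t) :
    IsIrr I s t W ↔ cls I W ∉ Submodule.span k (cls I '' Set.Ioi W) := by
  have : {x | ∃ q r : Quiver.Path s t, (⟨s, t, W⟩ : QPath V) = ⟨s, t, q⟩ ∧ q < r ∧ x = cls I r} =
      cls I '' Set.Ioi W := by
    ext x
    constructor
    · rintro ⟨q, r, h, hr, rfl⟩
      cases h
      exact ⟨r, hr, rfl⟩
    · rintro ⟨r, hr, rfl⟩
      exact ⟨W, r, rfl, hr, rfl⟩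
  rw [IsIrr, this]

theorem isIrr_iff_of_ne {a b : V} (p : Quiver.Path a b) (h : ¬(a = s ∧ b = t)) :
    IsIrr I s t p ↔ of k p ∉ I := by
  have : {x | ∃ q r : Quiver.Path s t, (⟨a, b, p⟩ : QPath V) = ⟨s, t, q⟩ ∧ q < r ∧ x = cls I r} =
      ∅ := by
    refine Set.eq_empty_of_forall_notMem ?_
    rintro x ⟨q, r, hq, -⟩
    cases hq
    exact h ⟨rfl, rfl⟩
  rw [IsIrr, this, Submodule.span_empty, Submodule.mem_bot, ← toAlg_of, toAlg_eq_zero]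

/-- Paths of length at most one are irreducible. -/
theorem IsAdmissible.isIrr (hI : IsAdmissible I) {a b : V} (p : Quiver.Path a b)
    (hp : p.length ≤ 1) : IsIrr I s t p := by
  classical
  intro h
  -- A dependence on later branches lifts to an element `of k p - y` of `I`, whose coefficient at
  -- the short path `p` must vanish. It equals one, because `y` involves only branches strictly
  -- later than `p`.
  have h1 : cls I p ∈ (Submodule.span k {x | ∃ q r : Quiver.Path s t,
      (⟨a, b, p⟩ : QPath V) = ⟨s, t, q⟩ ∧ q < r ∧ x = of k r}).map (toAlg I) := by
    rw [Submodule.map_span]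
    refine Submodule.span_mono ?_ h
    rintro _ ⟨q, r, hq, hr, rfl⟩
    exact ⟨_, ⟨q, r, hq, hr, rfl⟩, rfl⟩
  obtain ⟨y, hy, hyp⟩ := h1
  have h2 : of k p - y ∈ I := by
    rw [← toAlg_eq_zero I, map_sub, hyp, toAlg_of, sub_self]
  have h3 := hI.coeff_eq_zero h2 ⟨a, b, p⟩ hp
  have h4 : Submodule.span k {x | ∃ q r : Quiver.Path s t,
      (⟨a, b, p⟩ : QPath V) = ⟨s, t, q⟩ ∧ q < r ∧ x = of k r} ≤
      LinearMap.ker (extend (Pi.single (⟨a, b, p⟩ : QPath V) (1 : k))) := by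
    refine Submodule.span_le.2 ?_
    rintro _ ⟨q, r, hq, hr, rfl⟩
    refine (extend_of _ _).trans (Pi.single_eq_of_ne ?_ _)
    rw [hq]
    intro h
    cases h
    exact hr.false
  rw [map_sub, extend_of, LinearMap.mem_ker.1 (h4 hy), Pi.single_eq_same, sub_zero] at h3
  exact one_ne_zero h3

/-- Row reduction: descending from the last branch, every reducible branch is replaced by later
ones, which have already been reduced. -/
theorem cls_branch_mem_span [Finite (Quiver.Path s t)] (W : Quiver.Path s t) :
    cls I W ∈ Submodule.span k (cls I '' {r | W ≤ r ∧ IsIrr I s t r}) := by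
  induction W using WellFoundedGT.induction with
  | ind W ih =>
  by_cases hW : IsIrr I s t W
  · exact Submodule.subset_span ⟨W, ⟨le_rfl, hW⟩, rfl⟩
  · rw [isIrr_branch_iff, not_not] at hW
    refine Submodule.span_le.2 ?_ hW
    rintro _ ⟨r, hr, rfl⟩
    refine Submodule.span_mono (Set.image_mono fun q hq => ?_) (ih r hr)
    exact ⟨(le_of_lt hr).trans hq.1, hq.2⟩

/-- A path is irreducible, or lies in `I`, or is the leading branch of a relation. -/
theorem isIrr_or [Finite (Quiver.Path s t)] {p : ∀ {a b : V}, Quiver.Path a b → Prop}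
    (hirr : ∀ {a b : V} (q : Quiver.Path a b), IsIrr I s t q → p q)
    (hmem : ∀ {a b : V} (q : Quiver.Path a b), of k q ∈ I → p q)
    (hrel : ∀ (W : Quiver.Path s t) (f : PathAlgebra k V), IsNonmonRel I W f → p W)
    {a b : V} (q : Quiver.Path a b) : p q := by
  by_cases hq : IsIrr I s t q
  · exact hirr q hq
  by_cases hqI : of k q ∈ I
  · exact hmem q hqI
  by_cases h : a = s ∧ b = t
  · obtain ⟨rfl, rfl⟩ := h
    rw [isIrr_branch_iff, not_not] at hq
    -- The later branches are themselves reduced to irreducible ones, and the resulting combination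
    -- is lifted to `k Q`; this produces the `f` of a relation in reduced form.
    have h1 : cls I q ∈ (Submodule.span k
        {y | ∃ r : Quiver.Path a b, q < r ∧ IsIrr I a b r ∧ y = of k r}).map (toAlg I) := by
      rw [Submodule.map_span]
      refine Submodule.span_le.2 ?_ hq
      rintro _ ⟨r, hr, rfl⟩
      refine Submodule.span_mono ?_ (cls_branch_mem_span r)
      rintro _ ⟨r', hr', rfl⟩
      exact ⟨_, ⟨r', lt_of_lt_of_le hr hr'.1, hr'.2, rfl⟩, rfl⟩
    obtain ⟨f, hf, hfq⟩ := h1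
    refine hrel q f ⟨hqI, hf, ?_⟩
    rw [← toAlg_eq_zero I, map_sub, hfq, toAlg_of, sub_self]
  · exact absurd ((isIrr_iff_of_ne q h).2 hqI) hq

theorem cls_mem_span_irr [Finite (Quiver.Path s t)] {a b : V} (p : Quiver.Path a b) :
    cls I p ∈ Submodule.span k {x | ∃ q : Quiver.Path a b, IsIrr I s t q ∧ x = cls I q} := by
  refine isIrr_or (s := s) (t := t) (I := I) (p := fun {a b} p => cls I p ∈
    Submodule.span k {x | ∃ q : Quiver.Path a b, IsIrr I s t q ∧ x = cls I q}) ?_ ?_ ?_ p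
  · exact fun q hq => Submodule.subset_span ⟨q, hq, rfl⟩
  · intro a b q hq
    rw [← toAlg_of, (toAlg_eq_zero I).2 hq]
    exact Submodule.zero_mem _
  · intro W f _
    refine Submodule.span_mono ?_ (cls_branch_mem_span W)
    rintro _ ⟨r, hr, rfl⟩
    exact ⟨r, hr.2, rfl⟩

variable (I s t) in
/-- The set of irreducible paths. -/
def IrrPath : Type _ := {p : QPath V // IsIrr I s t p.path}

variable (I s t) in
/-- The classes in `A` of the irreducible paths. -/
def irrCls (p : IrrPath I s t) : PathAlgebra k V ⧸ I := cls I p.1.path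

theorem span_irrCls [Finite (Quiver.Path s t)] :
    Submodule.span k (Set.range (irrCls I s t)) = ⊤ := by
  refine eq_top_iff.2 fun x _ => ?_
  obtain ⟨x, rfl⟩ := toAlg_surjective I x
  induction x using PathAlgebra.induction with
  | h0 => rw [map_zero]; exact Submodule.zero_mem _
  | hadd x y hx hy => rw [map_add]; exact Submodule.add_mem _ (hx trivial) (hy trivial)
  | hsmul c x hx => rw [map_smul]; exact Submodule.smul_mem _ c (hx trivial)
  | hof a b p =>
    refine Submodule.span_mono ?_ (cls_mem_span_irr (s := s) (t := t) p)
    rintro _ ⟨q, hq, rfl⟩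
    exact ⟨⟨⟨a, b, q⟩, hq⟩, rfl⟩

theorem idem_mul_cls_mul_idem_of_ne {a b x y : V} (p : Quiver.Path a b) (h : ¬(a = x ∧ b = y)) :
    idem I x * cls I p * idem I y = 0 := by
  rw [idem_mul_cls]
  split_ifs with hx
  · rw [cls_mul_idem, if_neg fun hy => h ⟨hx, hy⟩]
  · exact zero_mul _

theorem idem_mul_cls_mul_idem {a b : V} (p : Quiver.Path a b) :
    idem I a * cls I p * idem I b = cls I p := by
  rw [idem_mul_cls, if_pos rfl, cls_mul_idem, if_pos rfl]

theorem irrPath_eq (hQ : IsToupie V s t) {i j : IrrPath I s t}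
    (h : ¬(i.1.src = s ∧ i.1.tgt = t)) (h1 : j.1.src = i.1.src) (h2 : j.1.tgt = i.1.tgt) :
    j = i := by
  obtain ⟨⟨a, b, p⟩, hp⟩ := j
  obtain ⟨⟨a', b', q⟩, hq⟩ := i
  dsimp only at h h1 h2
  subst h1 h2
  obtain rfl := hQ.path_eq h p q
  rfl

/-- Multiplying by vertices on both sides splits a relation into parts with fixed endpoints. A part
that does not run from `s` to `t` has a single term, with nonzero class. In the part made of
branches, the least branch with nonzero coefficient would be a combination of later ones. -/
theorem linearIndependent_irrCls (hQ : IsToupie V s t) :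
    LinearIndependent k (irrCls I s t) := by
  classical
  rw [linearIndependent_iff']
  intro S g hg
  by_contra! hne
  obtain ⟨i, hiS, hi⟩ := hne
  set x := i.1.src
  set y := i.1.tgt
  -- the part of the relation between `x` and `y`
  have h1 : ∑ j ∈ S with (j.1.src = x ∧ j.1.tgt = y), g j • irrCls I s t j = 0 := by
    have := congrArg (fun z => idem I x * z * idem I y) hg
    simp only [Finset.mul_sum, Finset.sum_mul, mul_zero, zero_mul, mul_smul_comm,
      smul_mul_assoc] at this
    rw [← this, Finset.sum_filter]
    refine Finset.sum_congr rfl fun j _ => ?_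
    split_ifs with h
    · rw [← h.1, ← h.2, irrCls, idem_mul_cls_mul_idem]
    · rw [irrCls, idem_mul_cls_mul_idem_of_ne _ h, smul_zero]
  by_cases hst : x = s ∧ y = t
  · -- the branch with the least index
    let T : Finset (IrrPath I s t) := {j ∈ S | (j.1.src = x ∧ j.1.tgt = y) ∧ g j ≠ 0}
    have hbr : ∀ j ∈ T, ∃ W : Quiver.Path s t, j.1 = ⟨s, t, W⟩ := by
      intro j hj
      obtain ⟨⟨⟨a, b, W⟩, hW⟩, rfl⟩ : ∃ j', j' = j := ⟨j, rfl⟩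
      obtain ⟨h2, h3⟩ := (Finset.mem_filter.1 hj).2.1
      obtain rfl : a = s := h2.trans hst.1
      obtain rfl : b = t := h3.trans hst.2
      exact ⟨W, rfl⟩
    have hiT : i ∈ T := Finset.mem_filter.2 ⟨hiS, ⟨rfl, rfl⟩, hi⟩
    -- A default branch, so that `w` can be a total function; only its values on `T` matter.
    have : Nonempty (Quiver.Path s t) := ⟨(hbr i hiT).choose⟩
    choose! w hw using hbr
    obtain ⟨j, hjT, hjmin⟩ := T.exists_min_image w ⟨i, hiT⟩
    have hcls : ∀ l ∈ T, irrCls I s t l = cls I (w l) := by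
      intro l hl
      change cls I l.1.path = _
      rw [hw l hl]
    have h2 : ∑ l ∈ T, g l • irrCls I s t l = 0 := by
      have hT : T = {j ∈ {j ∈ S | j.1.src = x ∧ j.1.tgt = y} | g j ≠ 0} :=
        (Finset.filter_filter _ _ _).symm
      rw [← h1, hT, Finset.sum_filter_of_ne]
      intro l _ hl h
      exact hl (by rw [h, zero_smul])
    have hj : IsIrr I s t (w j) := by
      have h3 := j.2
      rw [hw j hjT] at h3
      exact h3
    rw [isIrr_branch_iff] at hj
    refine hj ?_
    have hgj : g j ≠ 0 := (Finset.mem_filter.1 hjT).2.2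
    rw [← Finset.add_sum_erase _ _ hjT, hcls j hjT, add_eq_zero_iff_eq_neg] at h2
    have h4 : g j • cls I (w j) ∈ Submodule.span k (cls I '' Set.Ioi (w j)) := by
      rw [h2]
      refine Submodule.neg_mem _ (Submodule.sum_mem _ fun l hl => Submodule.smul_mem _ _ ?_)
      obtain ⟨hlj, hlT⟩ := Finset.mem_erase.1 hl
      rw [hcls l hlT]
      refine Submodule.subset_span ⟨w l, lt_of_le_of_ne (hjmin l hlT) fun h => hlj ?_, rfl⟩
      exact Subtype.ext (by rw [hw l hlT, hw j hjT, h])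
    exact (Submodule.smul_mem_iff _ hgj).1 h4
  · -- a unique path
    rw [Finset.sum_eq_single i] at h1
    · have h3 : cls I i.1.path = 0 := (smul_eq_zero.1 h1).resolve_left hi
      exact (isIrr_iff_of_ne _ hst).1 i.2 ((toAlg_eq_zero I).1 h3)
    · intro j hj hji
      obtain ⟨hj1, hj2⟩ := Finset.mem_filter.1 hj
      exact absurd (irrPath_eq hQ hst hj2.1 hj2.2) hji
    · intro h
      exact absurd (Finset.mem_filter.2 ⟨hiS, rfl, rfl⟩) h

/-- The basis of `A` that consists of the classes of the irreducible paths. -/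
def irrBasis [Finite (Quiver.Path s t)] (hQ : IsToupie V s t) :
    Module.Basis (IrrPath I s t) k (PathAlgebra k V ⧸ I) :=
  Module.Basis.mk (linearIndependent_irrCls hQ) span_irrCls.ge

end Irreducible

/-! ### The comparison map and the complex -/

section Comparison

variable {s t : V} [LinearOrder (Quiver.Path s t)] {I}

theorem irr_hom_ext [Finite (Quiver.Path s t)] {N : Type*} [AddCommGroup N] [Module k N]
    {f g : (PathAlgebra k V ⧸ I) →ₗ[k] N}
    (h : ∀ (a b : V) (p : Quiver.Path a b), IsIrr I s t p → f (cls I p) = g (cls I p)) : f = g :=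
  LinearMap.ext_on span_irrCls <| by
    rintro _ ⟨p, rfl⟩
    exact h _ _ _ p.2

/-- Bimodule maps out of `A ⊗_E Ā ⊗_E A` are determined by their values on irreducible paths. -/
theorem bar1_hom_ext [Finite (Quiver.Path s t)] {P : Type*} [AddCommGroup P] [Module k P]
    [Module (Env k (PathAlgebra k V ⧸ I)) P] [IsScalarTower k (Env k (PathAlgebra k V ⧸ I)) P]
    {f g : Bar1 I →ₗ[Env k (PathAlgebra k V ⧸ I)] P}
    (h : ∀ (a b : V) (p : Quiver.Path a b), IsIrr I s t p →
      f (genB I (cls I p)) = g (genB I (cls I p))) : f = g := by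
  refine bt_hom_ext fun m => ?_
  obtain ⟨a, rfl⟩ := (subE I).mkQ_surjective m
  have h1 : f.restrictScalars k ∘ₗ gen k (idem I) ∘ₗ bar I =
      g.restrictScalars k ∘ₗ gen k (idem I) ∘ₗ bar I := irr_hom_ext h
  exact LinearMap.congr_fun h1 a

/-- The linear map `A → A ⊗_E k Q₁ ⊗_E A` that sends an irreducible path `b` to the sum of all
`b₁ ⊗ α ⊗ b₃` with `b = b₁ α b₃` and `α` an arrow. -/
def factIrr [Finite (Quiver.Path s t)] (hQ : IsToupie V s t) :
    (PathAlgebra k V ⧸ I) →ₗ[k] P1 I :=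
  (irrBasis hQ).constr k fun p => factPath I p.1.path

theorem factIrr_cls [Finite (Quiver.Path s t)] (hQ : IsToupie V s t) {a b : V}
    (p : Quiver.Path a b) (hp : IsIrr I s t p) : factIrr hQ (cls I p) = factPath I p := by
  have h : irrBasis (I := I) hQ ⟨⟨a, b, p⟩, hp⟩ = cls I p := Module.Basis.mk_apply _ _ _
  rw [← h]
  exact (irrBasis hQ).constr_basis k _ _

/-- The map is prescribed on the basis of irreducible paths. It kills `E`, since trivial paths are
irreducible and have no factorization through an arrow, and its compatibility with the vertices can
be checked on the basis. -/
theorem exists_isEta1 [Finite (Quiver.Path s t)] (hQ : IsToupie V s t) (hI : IsAdmissible I) :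
    ∃ η : Bar1 I →ₗ[Env k (PathAlgebra k V ⧸ I)] P1 I, IsEta1 I s t η := by
  classical
  have hE : subE I ≤ LinearMap.ker (factIrr (I := I) hQ) := by
    refine Submodule.span_le.2 ?_
    rintro _ ⟨v, rfl⟩
    exact factIrr_cls hQ _ (hI.isIrr _ (Nat.zero_le 1))
  have hl : ∀ v a, factIrr hQ (idem I v * a) = lm k (idem I v) • factIrr hQ a := fun v a => by
    have : factIrr hQ ∘ₗ LinearMap.mulLeft k (idem I v) =
        Algebra.lsmul k k (P1 I) (lm k (idem I v)) ∘ₗ factIrr hQ := irr_hom_ext (s := s) (t := t) fun a b p hp => by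
      simp only [LinearMap.comp_apply, LinearMap.mulLeft_apply, Algebra.lsmul_coe, idem_mul_cls,
        factIrr_cls hQ p hp, lm_factPath, apply_ite (factIrr hQ), map_zero]
    exact LinearMap.congr_fun this a
  have hr : ∀ v a, factIrr hQ (a * idem I v) = rm k (idem I v) • factIrr hQ a := fun v a => by
    have : factIrr hQ ∘ₗ LinearMap.mulRight k (idem I v) =
        Algebra.lsmul k k (P1 I) (rm k (idem I v)) ∘ₗ factIrr hQ := irr_hom_ext (s := s) (t := t) fun a b p hp => by
      simp only [LinearMap.comp_apply, LinearMap.mulRight_apply, Algebra.lsmul_coe, cls_mul_idem,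
        factIrr_cls hQ p hp, rm_factPath, apply_ite (factIrr hQ), map_zero]
    exact LinearMap.congr_fun this a
  refine ⟨lift (M := Abar I) (e := idem I) (HomE.ofHom ((subE I).liftQ (factIrr hQ) hE)
    fun v m => ?_), fun a b p hp => ?_⟩
  · obtain ⟨a, rfl⟩ := (subE I).mkQ_surjective m
    exact ⟨hl v a, hr v a⟩
  · exact (lift_gen _ _).trans (factIrr_cls hQ p hp)

theorem existsUnique_isEta1 [Finite (Quiver.Path s t)] (hQ : IsToupie V s t)
    (hI : IsAdmissible I) :
    ∃! η : Bar1 I →ₗ[Env k (PathAlgebra k V ⧸ I)] P1 I, IsEta1 I s t η := by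
  obtain ⟨η, hη⟩ := exists_isEta1 hQ hI
  exact ⟨η, hη, fun η' hη' => bar1_hom_ext fun a b p hp =>
    (hη' a b p hp).trans (hη a b p hp).symm⟩

variable {η : Bar1 I →ₗ[Env k (PathAlgebra k V ⧸ I)] P1 I}

theorem d0_comp_eta [Finite (Quiver.Path s t)] (hη : IsEta1 I s t η) :
    d0 I ∘ₗ η = delta0 I :=
  bar1_hom_ext fun a b p hp => by
    rw [LinearMap.comp_apply, hη a b p hp, d0_factPath, delta0_genB]

theorem d1_gen (r : Rel I s t) : d1 I s t (gen k (idem I) (Finsupp.single r 1)) = fact I r.val := by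
  refine (lift_gen _ _).trans ?_
  exact (Finsupp.linearCombination_single k (1 : k) r).trans (one_smul k _)

theorem toAlg_val (r : Rel I s t) : toAlg I r.val = 0 := by
  rw [toAlg_eq_zero]
  cases r with
  | mon σ h => exact h.1
  | nonmon W f h => exact h.2.2

/-- By telescoping, `d₀` of the factorizations of a relation depends only on the class of the
relation in `A`, which is zero. -/
theorem d0_comp_d1 : d0 I ∘ₗ d1 I s t = 0 :=
  bt_symbol_hom_ext fun r => by
    rw [LinearMap.comp_apply, d1_gen, d0_fact, toAlg_val, map_zero, LinearMap.zero_apply]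

theorem D1_comp_D0 : D1 I s t ∘ₗ D0 I = 0 := by
  refine LinearMap.ext fun F => HomE.ext fun m => ?_
  change lift (pull (d0 I) F) (d1 I s t (gen k (idem I) m)) = 0
  have h : lift (pull (d0 I) F) = lift F ∘ₗ d0 I := homF.symm_apply_apply (lift F ∘ₗ d0 I)
  rw [h]
  change lift F ((d0 I ∘ₗ d1 I s t) _) = 0
  rw [d0_comp_d1, LinearMap.zero_apply, map_zero]

/-! ### The bracket on parallel pairs -/

theorem par_single (α γ : Arrow V) (h : Quiver.Path α.src α.tgt) :
    HomE.toHom (par I α h) (Finsupp.single γ 1) = symb I α (cls I h) (Finsupp.single γ 1) := rfl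

open Classical in
theorem symb_single {J : Ideal (PathAlgebra k V)} (α γ : Arrow V) (x : PathAlgebra k V ⧸ J) :
    symb J α x (Finsupp.single γ 1) = if γ = α then x else 0 :=
  (Finsupp.linearCombination_single k (1 : k) γ).trans (one_smul k _)

/-- A factorization through an arrow other than `α` contributes zero, and one through `α`
contributes the path with that occurrence replaced. Both sides satisfy the same recursion along the
path. -/
theorem derivOf_par (α : Arrow V) (h : Quiver.Path α.src α.tgt) {a b : V} (p : Quiver.Path a b) :
    derivOf (par I α h) (of k p) = replaced I α h p := by
  classical
  rw [derivOf_of]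
  induction p with
  | nil => exact map_zero _
  | cons p β ih =>
    rw [factPath, map_add, map_smul, map_smul, ih, lm_smul, rm_smul, lift_genA, par_single,
      symb_single, replaced, replaced, replace, map_add, map_mul]
    congr 1
    split_ifs
    · rfl
    · rw [mul_zero, map_zero]

theorem span_par [∀ x y : V, Finite (x ⟶ y)] [Finite (Quiver.Path s t)] :
    Submodule.span k {F : C1 I | ∃ (α : Arrow V) (h : Quiver.Path α.src α.tgt),
      IsIrr I s t h ∧ F = par I α h} = ⊤ := by
  classical
  have := finite_arrow (W := V)
  have := Fintype.ofFinite (Arrow V)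
  set S := Submodule.span k {F : C1 I | ∃ (α : Arrow V) (h : Quiver.Path α.src α.tgt),
      IsIrr I s t h ∧ F = par I α h}
  -- Cutting `x` down by the endpoints of `α` discards the irreducible paths not parallel to `α`, so
  -- that `x` may range over all of `A` in the induction. Values of cochains are unchanged by the
  -- cut.
  have key : ∀ (α : Arrow V) (x : PathAlgebra k V ⧸ I),
      ∃ F ∈ S, HomE.toHom F = symb I α (idem I α.src * x * idem I α.tgt) := by
    intro α x
    have hx : x ∈ Submodule.span k (Set.range (irrCls I s t)) := by
      rw [span_irrCls]; trivial
    induction hx using Submodule.span_induction with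
    | zero => exact ⟨0, S.zero_mem, by ext; simp [symb]⟩
    | add x y _ _ hx hy =>
      obtain ⟨F, hF, hFx⟩ := hx
      obtain ⟨G, hG, hGy⟩ := hy
      refine ⟨F + G, S.add_mem hF hG, Finsupp.lhom_ext' fun γ => LinearMap.ext_ring ?_⟩
      rw [map_add, hFx, hGy]
      simp only [LinearMap.comp_apply, LinearMap.add_apply, Finsupp.lsingle_apply, symb_single]
      split_ifs <;> simp [mul_add, add_mul]
    | smul c x _ hx =>
      obtain ⟨F, hF, hFx⟩ := hx
      refine ⟨c • F, S.smul_mem c hF, Finsupp.lhom_ext' fun γ => LinearMap.ext_ring ?_⟩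
      rw [map_smul, hFx]
      simp only [LinearMap.comp_apply, LinearMap.smul_apply, Finsupp.lsingle_apply, symb_single]
      split_ifs <;> simp
    | mem x hx =>
      obtain ⟨⟨⟨a, b, p⟩, hp⟩, rfl⟩ := hx
      by_cases h : a = α.src ∧ b = α.tgt
      · obtain ⟨rfl, rfl⟩ := h
        refine ⟨par I α p, Submodule.subset_span ⟨α, p, hp, rfl⟩, ?_⟩
        change _ = symb I α (_ * cls I p * _)
        rw [idem_mul_cls_mul_idem]; rfl
      · refine ⟨0, S.zero_mem, ?_⟩
        change _ = symb I α (_ * cls I p * _)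
        rw [idem_mul_cls_mul_idem_of_ne p h]
        ext; simp [symb]
  refine eq_top_iff.2 fun F _ => ?_
  choose G hGS hG using fun α => key α (HomE.toHom F (Finsupp.single α 1))
  have hF : F = ∑ α, G α := C1_ext fun γ => by
    rw [map_sum, LinearMap.sum_apply]
    simp only [hG, symb_single, C1_idem_left, C1_idem_right]
    rw [Finset.sum_ite_eq, if_pos (Finset.mem_univ _)]
  rw [hF]
  exact S.sum_mem fun α _ => hGS α

theorem infl_pull_irr (hη : IsEta1 I s t η) (F : C1 I) {a b : V} (p : Quiver.Path a b)
    (hp : IsIrr I s t p) : infl I (pull η F) (cls I p) = derivOf F (of k p) := by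
  rw [infl_pull, hη a b p hp, derivOf_of]

/-- An arrow is irreducible and has itself as its only factorization. In effect `φ₁* η₁*` is the
identity on all cochains, cocycles or not. -/
theorem infl_pull_arr (hI : IsAdmissible I) (hη : IsEta1 I s t η) (F : C1 I) (α : Arrow V) :
    infl I (pull η F) (arr I α) = HomE.toHom F (Finsupp.single α 1) := by
  rw [arr, infl_pull_irr hη F _ (hI.isIrr _ le_rfl), derivOf_of, factPath_toPath, lift_genA]

theorem minBracket_single (hI : IsAdmissible I) (hη : IsEta1 I s t η) (F G : C1 I) (γ : Arrow V) :
    HomE.toHom (minBracket I η F G) (Finsupp.single γ 1) =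
      infl I (pull η F) (HomE.toHom G (Finsupp.single γ 1)) -
        infl I (pull η G) (HomE.toHom F (Finsupp.single γ 1)) := by
  refine (pull_phi1_single _ _).trans ?_
  change infl I (redBracket I (pull η F) (pull η G)) _ = _
  rw [infl_redBracket, LinearMap.sub_apply, Module.End.mul_apply, Module.End.mul_apply,
    infl_pull_arr hI hη, infl_pull_arr hI hη]

/-- At an arrow `γ` the inner cochain yields zero or one of the irreducible paths `b` and `h`, and
there `η₁*` is the derivation that substitutes one path for an arrow. Irreducibility is what allows
the substitution to be made in the path itself. -/
theorem minBracket_par (hI : IsAdmissible I) (hη : IsEta1 I s t η) (α β : Arrow V)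
    (h : Quiver.Path α.src α.tgt) (b : Quiver.Path β.src β.tgt) (hh : IsIrr I s t h)
    (hb : IsIrr I s t b) :
    HomE.toHom (minBracket I η (par I α h) (par I β b)) =
      symb I β (replaced I α h b) - symb I α (replaced I β b h) := by
  classical
  refine Finsupp.lhom_ext' fun γ => LinearMap.ext_ring ?_
  rw [LinearMap.comp_apply, LinearMap.comp_apply, Finsupp.lsingle_apply, LinearMap.sub_apply]
  rw [minBracket_single hI hη, par_single, par_single, symb_single, symb_single, symb_single,
    symb_single, apply_ite (infl I _), apply_ite (infl I _), infl_pull_irr hη _ b hb,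
    infl_pull_irr hη _ h hh, derivOf_par, derivOf_par, map_zero, map_zero]

/-! ### Cocycles and derivations of the algebra -/

theorem D1_single (F : C1 I) (r : Rel I s t) :
    HomE.toHom (D1 I s t F) (Finsupp.single r 1) = derivOf F r.val := by
  refine (pull_apply _ _ _).trans ?_
  rw [d1_gen, derivOf_apply]

theorem mem_ker_D1 (F : C1 I) :
    F ∈ LinearMap.ker (D1 I s t) ↔ ∀ r : Rel I s t, derivOf F r.val = 0 := by
  rw [LinearMap.mem_ker]
  constructor
  · intro h r
    rw [← D1_single, h]; simp
  · intro h
    have : HomE.toHom (D1 I s t F) = 0 := Finsupp.lhom_ext' fun r => LinearMap.ext_ring <| by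
      change HomE.toHom (D1 I s t F) (Finsupp.single r 1) = 0
      rw [D1_single, h]
    exact HomE.ext fun m => by rw [this, map_zero]

/-- The derivation of a cocycle vanishes on every path in `I`. -/
theorem derivOf_of_mem {F : C1 I} (hF : F ∈ LinearMap.ker (D1 I s t)) (n : ℕ) {a b : V}
    (p : Quiver.Path a b) (hn : p.length = n) (hp : of k p ∈ I) : derivOf F (of k p) = 0 := by
  induction n using Nat.strong_induction_on generalizing a b with
  | h n ih =>
  by_cases h : IsMonRel I p
  · exact (mem_ker_D1 F).1 hF (.mon p h)
  · rw [IsMonRel] at h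
    push Not at h
    -- A path in `I` that is not a monomial relation has a shorter subpath `r` in `I`. In the
    -- Leibniz expansion every term contains the class of `r` or its derivative, and both are zero.
    obtain ⟨x, y, q, r, w, rfl, hl, hr⟩ := h hp
    have h1 := ih r.length (by rw [Quiver.Path.length_comp, Quiver.Path.length_comp] at hn; omega)
      r rfl hr
    rw [← of_mul_of, ← of_mul_of, derivOf_mul, derivOf_mul, toAlg_mul, h1,
      (toAlg_eq_zero I).2 hr]
    simp

/-- The reduced cochain of a cocycle `F` is induced by the derivation of `F`. -/
theorem infl_pull_toAlg [Finite (Quiver.Path s t)] (hη : IsEta1 I s t η) {F : C1 I}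
    (hF : F ∈ LinearMap.ker (D1 I s t)) (x : PathAlgebra k V) :
    infl I (pull η F) (toAlg I x) = derivOf F x := by
  have : infl I (pull η F) ∘ₗ toAlg I = derivOf F := hom_ext fun a b p => by
    refine isIrr_or (s := s) (t := t) (I := I) (p := fun {a b} p =>
      (infl I (pull η F) ∘ₗ toAlg I) (of k p) = derivOf F (of k p)) ?_ ?_ ?_ p
    · exact fun q hq => infl_pull_irr hη F q hq
    · intro a b q hq
      rw [LinearMap.comp_apply, (toAlg_eq_zero I).2 hq, map_zero, derivOf_of_mem hF _ q rfl hq]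
    · intro W f h
      -- The cocycle condition gives the derivation equal values on `W` and `f`, while these have
      -- the same class in `A`. The claim for `W` thus passes to `f`, a combination of irreducible
      -- branches, where it is known.
      have h1 := (mem_ker_D1 F).1 hF (.nonmon W f h)
      rw [Rel.val, map_sub, sub_eq_zero] at h1
      have h2 : toAlg I (of k W) = toAlg I f := by
        rw [← sub_eq_zero, ← map_sub, toAlg_eq_zero]
        exact h.2.2
      have h3 : Submodule.span k {y | ∃ r : Quiver.Path s t, W < r ∧ IsIrr I s t r ∧ y = of k r} ≤
          LinearMap.eqLocus (infl I (pull η F) ∘ₗ toAlg I) (derivOf F) := by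
        refine Submodule.span_le.2 ?_
        rintro _ ⟨r, -, hr, rfl⟩
        exact infl_pull_irr hη F r hr
      rw [LinearMap.comp_apply, h2, h1]
      exact h3 h.2.1
  exact LinearMap.congr_fun this x

theorem infl_pull_mem [Finite (Quiver.Path s t)] (hη : IsEta1 I s t η) {F : C1 I}
    (hF : F ∈ LinearMap.ker (D1 I s t)) :
    infl I (pull η F) ∈ hochZ1 k (PathAlgebra k V ⧸ I) := by
  rw [mem_hochZ1]
  intro x y
  obtain ⟨x, rfl⟩ := toAlg_surjective I x
  obtain ⟨y, rfl⟩ := toAlg_surjective I y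
  rw [← toAlg_mul, infl_pull_toAlg hη hF, infl_pull_toAlg hη hF, infl_pull_toAlg hη hF,
    derivOf_mul]

theorem derivOf_pull_phi1 {f : CBar1 I} (hf : infl I f ∈ hochZ1 k (PathAlgebra k V ⧸ I))
    (x : PathAlgebra k V) : derivOf (pull (phi1 I) f) x = infl I f (toAlg I x) :=
  derivOf_eq _ ((mem_hochZ1 _).1 hf) (infl_idem f) _ (pull_phi1_single f) x

/-- A derivation of `A` composed with the quotient map kills `I`, in particular the relations. -/
theorem pull_phi1_mem {f : CBar1 I} (hf : infl I f ∈ hochZ1 k (PathAlgebra k V ⧸ I)) :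
    pull (phi1 I) f ∈ LinearMap.ker (D1 I s t) :=
  (mem_ker_D1 _).2 fun r => by rw [derivOf_pull_phi1 hf, toAlg_val, map_zero]

/-- Both sides are derivations that kill the vertices and agree on arrows. The cocycle condition
matters here: a general reduced cochain need not be determined by its values on arrows. -/
theorem pull_eta_pull_phi1 [Finite (Quiver.Path s t)] (hη : IsEta1 I s t η) {f : CBar1 I}
    (hf : infl I f ∈ hochZ1 k (PathAlgebra k V ⧸ I)) : pull η (pull (phi1 I) f) = f :=
  infl_injective <| LinearMap.ext fun a => by
    obtain ⟨x, rfl⟩ := toAlg_surjective I a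
    rw [infl_pull_toAlg hη (pull_phi1_mem hf), derivOf_pull_phi1 hf]

end Comparison

/-! ### The isomorphism with first Hochschild cohomology and the bracket -/

section Cohomology

attribute [local instance] LieRing.ofAssociativeRing

variable {s t : V} [LinearOrder (Quiver.Path s t)] {I}
  {η : Bar1 I →ₗ[Env k (PathAlgebra k V ⧸ I)] P1 I}

theorem hochD0_apply {A : Type*} [Ring A] [Algebra k A] (a x : A) :
    hochD0 k A a x = x * a - a * x := rfl

theorem hochD0_mem {A : Type*} [Ring A] [Algebra k A] (a : A) : hochD0 k A a ∈ hochZ1 k A := by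
  rw [mem_hochZ1]
  intro x y
  simp only [hochD0_apply]
  noncomm_ring

/-- The element `∑ u(e_v)` of `A` that corresponds to a `0`-cochain `u`. -/
def vertexSum (u : C0 I) : PathAlgebra k V ⧸ I := lift u (oneP0 I)

/-- The identity `d₀ η₁ = δ₀` turns the coboundary of `u` into the image of `a ⊗ 1 - 1 ⊗ a` under
the bimodule map of `u`, which is a commutator with the image of `1 ⊗ 1`. -/
theorem infl_pull_D0 [Finite (Quiver.Path s t)] (hη : IsEta1 I s t η) (u : C0 I) :
    infl I (pull η (D0 I u)) = hochD0 k _ (vertexSum u) := by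
  refine LinearMap.ext fun a => ?_
  have h : lift (pull (d0 I) u) = lift u ∘ₗ d0 I := homF.symm_apply_apply (lift u ∘ₗ d0 I)
  rw [infl_pull, D0, h]
  change lift u ((d0 I ∘ₗ η) _) = _
  rw [d0_comp_eta hη, delta0_genB]
  change lift u (lm k a • oneP0 I - rm k a • oneP0 I) = _
  rw [map_sub, map_smul, map_smul, lm_smul, rm_smul]
  rfl

theorem D0_single (u : C0 I) (α : Arrow V) :
    HomE.toHom (D0 I u) (Finsupp.single α 1) =
      hochD0 k _ (vertexSum u) (arr I α) := by
  change lift u (d0 I (genA I α)) = _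
  rw [d0_genA]
  change lift u (lm k _ • oneP0 I - rm k _ • oneP0 I) = _
  rw [map_sub, map_smul, map_smul, lm_smul, rm_smul]
  rfl

/-- The cochain is `e_v ↦ a e_v`; commutation with the vertices makes it compatible with the left
action, and the vertices sum to one. -/
theorem exists_vertexSum_eq (a : PathAlgebra k V ⧸ I)
    (ha : ∀ v, idem I v * a = a * idem I v) : ∃ u : C0 I, vertexSum u = a := by
  classical
  refine ⟨onSymbols (fun v => a * idem I v) (fun v w => ?_) fun v w => ?_, ?_⟩
  · change _ = if w = v then _ else _
    rw [lm_smul, ← mul_assoc, ha, mul_assoc, idem_mul_idem, mul_ite, mul_zero]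
    split_ifs with h
    · rw [h]
    · rfl
  · change _ = if w = v then _ else _
    rw [rm_smul, mul_assoc, idem_mul_idem, mul_ite, mul_zero]
    simp only [eq_comm]
  · rw [vertexSum, oneP0, map_sum]
    refine Eq.trans ?_ (mul_one a)
    rw [one_eq_sum_idem, Finset.mul_sum]
    refine Finset.sum_congr rfl fun v _ => (lift_gen _ _).trans ?_
    exact (Finsupp.linearCombination_single k (1 : k) v).trans (one_smul k _)

/-- A derivation of `A` vanishes on the vertices up to an inner derivation. -/
theorem derivation_add_inner_idem (D : Module.End k (PathAlgebra k V ⧸ I))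
    (hD : ∀ x y, D (x * y) = x * D y + D x * y) (v : V) :
    (D + hochD0 k _ (∑ w, D (idem I w) * idem I w)) (idem I v) = 0 := by
  classical
  -- By the Leibniz rule for `e_v e_w`, the sum splits into the terms `D(e_v e_w) e_w`, of which
  -- only `w = v` survives, minus the terms `D(e_v) e_w`, which add up to `D(e_v)`. Subtracting the
  -- product in the other order leaves `-D(e_v)`.
  have h1 : idem I v * (∑ w, D (idem I w) * idem I w) = D (idem I v) * idem I v - D (idem I v) := by
    have h2 : ∀ w, idem I v * (D (idem I w) * idem I w) =
        D (idem I v * idem I w) * idem I w - D (idem I v) * idem I w := fun w => by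
      have h3 : idem I w * idem I w = idem I w := by rw [idem_mul_idem, if_pos rfl]
      rw [hD, add_mul, mul_assoc (D (idem I v)), h3, mul_assoc]
      abel
    rw [Finset.mul_sum]
    simp only [h2]
    rw [Finset.sum_sub_distrib, ← Finset.mul_sum, ← one_eq_sum_idem, mul_one]
    congr 1
    rw [Finset.sum_eq_single v]
    · rw [idem_mul_idem, if_pos rfl]
    · intro w _ hw
      rw [idem_mul_idem, if_neg hw, map_zero, zero_mul]
    · simp
  have h2 : (∑ w, D (idem I w) * idem I w) * idem I v = D (idem I v) * idem I v := by
    rw [Finset.sum_mul, Finset.sum_eq_single v]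
    · rw [mul_assoc, idem_mul_idem, if_pos rfl]
    · intro w _ hw
      rw [mul_assoc, idem_mul_idem, if_neg hw.symm, mul_zero]
    · simp
  rw [LinearMap.add_apply, hochD0_apply, h1, h2]
  abel

/-- A derivation of `A` that vanishes on the vertices is a reduced cochain. -/
theorem exists_infl_eq (D : Module.End k (PathAlgebra k V ⧸ I))
    (hD : ∀ x y, D (x * y) = x * D y + D x * y) (hE : ∀ v, D (idem I v) = 0) :
    ∃ f : CBar1 I, infl I f = D := by
  have h : subE I ≤ LinearMap.ker D := by
    refine Submodule.span_le.2 ?_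
    rintro _ ⟨v, rfl⟩
    exact hE v
  refine ⟨HomE.ofHom ((subE I).liftQ D h) fun v m => ?_, rfl⟩
  obtain ⟨a, rfl⟩ := (subE I).mkQ_surjective m
  rw [lm_smul, rm_smul]
  constructor
  · change D (idem I v * a) = idem I v * D a
    rw [hD, hE, zero_mul, add_zero]
  · change D (a * idem I v) = D a * idem I v
    rw [hD, hE, mul_zero, zero_add]

theorem mk_hoch_eq_zero {A : Type*} [Ring A] [Algebra k A] (D : hochZ1 k A) :
    (LieSubmodule.Quotient.mk D : HH1 k A) = 0 ↔ ∃ a, hochD0 k A a = D :=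
  (Submodule.Quotient.mk_eq_zero (hochB1 k A).toSubmodule)

/-- The linear map from the cocycles of the minimal resolution to `HH¹(A)` induced by `η₁`. -/
def toHH1 [Finite (Quiver.Path s t)] (hη : IsEta1 I s t η) :
    LinearMap.ker (D1 I s t) →ₗ[k] HH1 k (PathAlgebra k V ⧸ I) :=
  (hochB1 k (PathAlgebra k V ⧸ I)).toSubmodule.mkQ ∘ₗ
    ((infl I ∘ₗ pull η ∘ₗ (LinearMap.ker (D1 I s t)).subtype).codRestrict
      (hochZ1 k (PathAlgebra k V ⧸ I)).toSubmodule fun F => infl_pull_mem hη F.2)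

theorem toHH1_apply [Finite (Quiver.Path s t)] (hη : IsEta1 I s t η)
    (F : LinearMap.ker (D1 I s t)) :
    toHH1 hη F = LieSubmodule.Quotient.mk ⟨infl I (pull η F.1), infl_pull_mem hη F.2⟩ := rfl

/-- An inner correction makes a derivation kill the vertices. It is then a reduced cocycle `f`, and
`φ₁* f` is a preimage because `η₁* φ₁* f = f`. -/
theorem toHH1_surjective [Finite (Quiver.Path s t)] (hη : IsEta1 I s t η) :
    Function.Surjective (toHH1 hη) := by
  intro x
  obtain ⟨⟨D, hD⟩, rfl⟩ := Submodule.mkQ_surjective _ x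
  set a := ∑ w, D (idem I w) * idem I w
  have hD' : D + hochD0 k _ a ∈ hochZ1 k (PathAlgebra k V ⧸ I) :=
    (hochZ1 k (PathAlgebra k V ⧸ I)).add_mem hD (hochD0_mem a)
  obtain ⟨f, hf⟩ := exists_infl_eq (D + hochD0 k _ a) ((mem_hochZ1 _).1 hD')
    (derivation_add_inner_idem D ((mem_hochZ1 _).1 hD))
  have hf' : infl I f ∈ hochZ1 k (PathAlgebra k V ⧸ I) := by rwa [hf]
  refine ⟨⟨pull (phi1 I) f, pull_phi1_mem hf'⟩, ?_⟩
  rw [toHH1_apply]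
  refine (Submodule.Quotient.eq (hochB1 k (PathAlgebra k V ⧸ I)).toSubmodule).2 ⟨a, ?_⟩
  change hochD0 k _ a = infl I (pull η (pull (phi1 I) f)) - D
  rw [pull_eta_pull_phi1 hη hf', hf, add_sub_cancel_left]

/-- If the derivation of a cocycle is inner, given by `a`, then `a` commutes with the vertices
because the derivation kills them. So `a` comes from a 0-cochain, whose coboundary has the same
values on arrows. -/
theorem ker_toHH1 [Finite (Quiver.Path s t)] (hI : IsAdmissible I) (hη : IsEta1 I s t η) :
    LinearMap.ker (toHH1 hη) =
      (LinearMap.range (D0 I)).comap (LinearMap.ker (D1 I s t)).subtype := by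
  ext F
  rw [LinearMap.mem_ker, toHH1_apply, mk_hoch_eq_zero]
  constructor
  · rintro ⟨a, ha⟩
    replace ha : hochD0 k _ a = infl I (pull η F.1) := ha
    obtain ⟨u, rfl⟩ := exists_vertexSum_eq a fun v => by
      rw [← sub_eq_zero, ← hochD0_apply (k := k), ha, infl_idem]
    refine ⟨u, C1_ext fun α => ?_⟩
    rw [D0_single, ha, infl_pull_arr hI hη]; rfl
  · rintro ⟨u, hu⟩
    refine ⟨vertexSum u, ?_⟩
    rw [← infl_pull_D0 hη, hu]; rfl

/-- The isomorphism `Ker D₁ / Im D₀ ≃ HH¹(A)` induced by `η₁`. -/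
def h1Equiv [Finite (Quiver.Path s t)] (hI : IsAdmissible I) (hη : IsEta1 I s t η) :
    H1min I s t ≃ₗ[k] HH1 k (PathAlgebra k V ⧸ I) :=
  (Submodule.quotEquivOfEq _ _ (ker_toHH1 hI hη).symm).trans
    ((toHH1 hη).quotKerEquivOfSurjective (toHH1_surjective hη))

theorem h1Equiv_mk [Finite (Quiver.Path s t)] (hI : IsAdmissible I) (hη : IsEta1 I s t η)
    (F : LinearMap.ker (D1 I s t)) :
    h1Equiv hI hη (Submodule.Quotient.mk F) =
      LieSubmodule.Quotient.mk ⟨infl I (pull η F.1), infl_pull_mem hη F.2⟩ := rfl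

theorem h1Equiv_symm_mk [Finite (Quiver.Path s t)] (hI : IsAdmissible I) (hη : IsEta1 I s t η)
    (f : CBar1 I) (hf : infl I f ∈ hochZ1 k (PathAlgebra k V ⧸ I)) :
    (h1Equiv hI hη).symm (LieSubmodule.Quotient.mk ⟨infl I f, hf⟩) =
      Submodule.Quotient.mk ⟨pull (phi1 I) f, pull_phi1_mem hf⟩ := by
  rw [LinearEquiv.symm_apply_eq, h1Equiv_mk]
  congr 2
  rw [pull_eta_pull_phi1 hη hf]

theorem commutator_mem_hochZ1 {A : Type*} [Ring A] [Algebra k A] {D D' : Module.End k A}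
    (h : D ∈ hochZ1 k A) (h' : D' ∈ hochZ1 k A) : D * D' - D' * D ∈ hochZ1 k A := by
  rw [← LieRing.of_associative_ring_bracket]
  exact (hochZ1 k A).lie_mem h h'

theorem infl_redBracket_mem {f g : CBar1 I}
    (hf : infl I f ∈ hochZ1 k (PathAlgebra k V ⧸ I))
    (hg : infl I g ∈ hochZ1 k (PathAlgebra k V ⧸ I)) :
    infl I (redBracket I f g) ∈ hochZ1 k (PathAlgebra k V ⧸ I) := by
  rw [infl_redBracket]
  exact commutator_mem_hochZ1 hf hg

theorem minBracket_mem [Finite (Quiver.Path s t)] (hη : IsEta1 I s t η)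
    (F G : LinearMap.ker (D1 I s t)) :
    minBracket I η F.1 G.1 ∈ LinearMap.ker (D1 I s t) :=
  pull_phi1_mem (infl_redBracket_mem (infl_pull_mem hη F.2) (infl_pull_mem hη G.2))

/-- The commutator of the two derivations is again a reduced cocycle, and `φ₁*` of it is the bracket
of `F` and `G` by definition. The description of the inverse isomorphism on reduced cocycles then
gives the claim. -/
theorem h1Equiv_bracket [Finite (Quiver.Path s t)] (hI : IsAdmissible I) (hη : IsEta1 I s t η)
    (F G : LinearMap.ker (D1 I s t)) :
    ⁅h1Equiv hI hη (Submodule.Quotient.mk F), h1Equiv hI hη (Submodule.Quotient.mk G)⁆ =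
      h1Equiv hI hη (Submodule.Quotient.mk ⟨minBracket I η F.1 G.1, minBracket_mem hη F G⟩) := by
  have hFG := infl_redBracket_mem (infl_pull_mem hη F.2) (infl_pull_mem hη G.2)
  have h := h1Equiv_symm_mk hI hη (redBracket I (pull η F.1) (pull η G.1)) hFG
  rw [LinearEquiv.symm_apply_eq] at h
  exact Eq.trans rfl h

end Cohomology

end Proof

end Toupie

end

theorem mainTheorem10 {k : Type*} {V : Type*} [Field k] [Fintype V] [Quiver V]
    [∀ x y : V, Finite (x ⟶ y)] {s t : V} (hQ : Toupie.IsToupie V s t)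
    (I : Ideal (Toupie.PathAlgebra k V)) [I.IsTwoSided] (hI : Toupie.IsAdmissible I)
    [LinearOrder (Quiver.Path s t)] :
    -- the comparison map `η₁` exists and is unique
    (∃! η : Toupie.Bar1 I →ₗ[Toupie.Env k (Toupie.PathAlgebra k V ⧸ I)] Toupie.P1 I,
      Toupie.IsEta1 I s t η) ∧
    ∀ η : Toupie.Bar1 I →ₗ[Toupie.Env k (Toupie.PathAlgebra k V ⧸ I)] Toupie.P1 I,
      Toupie.IsEta1 I s t η →
      -- `η₁` and `φ₁` are compatible with the differentials of the two resolutions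
      Toupie.d0 I ∘ₗ η = Toupie.delta0 I ∧
      Toupie.delta0 I ∘ₗ Toupie.phi1 I = Toupie.d0 I ∧
      Toupie.D1 I s t ∘ₗ Toupie.D0 I = 0 ∧
      -- the elements `α ‖ h`, with `h` an irreducible path, span the space of 1-cochains
      Submodule.span k {F : Toupie.C1 I | ∃ (α : Toupie.Arrow V) (h : Quiver.Path α.src α.tgt),
        Toupie.IsIrr I s t h ∧ F = Toupie.par I α h} = ⊤ ∧
      -- the formula for the bracket
      (∀ (α β : Toupie.Arrow V) (h : Quiver.Path α.src α.tgt) (b : Quiver.Path β.src β.tgt),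
        Toupie.IsIrr I s t h → Toupie.IsIrr I s t b →
        Toupie.HomE.toHom (Toupie.minBracket I η (Toupie.par I α h) (Toupie.par I β b)) =
          Toupie.symb I β (Toupie.replaced I α h b) -
            Toupie.symb I α (Toupie.replaced I β b h)) ∧
      -- it induces the Gerstenhaber bracket of `HH¹(A)` under the isomorphism given by `η₁`, `φ₁`
      ∃ Θ : Toupie.H1min I s t ≃ₗ[k] Toupie.HH1 k (Toupie.PathAlgebra k V ⧸ I),
        (∀ F : LinearMap.ker (Toupie.D1 I s t),
          ∃ hF : Toupie.infl I (Toupie.pull η F.1) ∈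
              Toupie.hochZ1 k (Toupie.PathAlgebra k V ⧸ I),
            Θ (Submodule.Quotient.mk F) =
              LieSubmodule.Quotient.mk ⟨Toupie.infl I (Toupie.pull η F.1), hF⟩) ∧
        (∀ (f : Toupie.CBar1 I)
          (hf : Toupie.infl I f ∈ Toupie.hochZ1 k (Toupie.PathAlgebra k V ⧸ I)),
          ∃ hφ : Toupie.pull (Toupie.phi1 I) f ∈ LinearMap.ker (Toupie.D1 I s t),
            Θ.symm (LieSubmodule.Quotient.mk ⟨Toupie.infl I f, hf⟩) =
              Submodule.Quotient.mk ⟨Toupie.pull (Toupie.phi1 I) f, hφ⟩) ∧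
        ∀ F G : LinearMap.ker (Toupie.D1 I s t),
          ∃ hFG : Toupie.minBracket I η F.1 G.1 ∈ LinearMap.ker (Toupie.D1 I s t),
            ⁅Θ (Submodule.Quotient.mk F), Θ (Submodule.Quotient.mk G)⁆ =
              Θ (Submodule.Quotient.mk ⟨Toupie.minBracket I η F.1 G.1, hFG⟩) := by
  -- Finiteness of the set of branches makes descending induction along their order possible, on
  -- which the row reduction rests.
  have : Finite (Quiver.Path s t) := hQ.finite_path s t
  refine ⟨Toupie.existsUnique_isEta1 hQ hI, fun η hη => ?_⟩
  exact ⟨Toupie.d0_comp_eta hη, Toupie.delta0_comp_phi1 I, Toupie.D1_comp_D0, Toupie.span_par,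
    Toupie.minBracket_par hI hη, Toupie.h1Equiv hI hη,
    fun F => ⟨Toupie.infl_pull_mem hη F.2, Toupie.h1Equiv_mk hI hη F⟩,
    fun f hf => ⟨Toupie.pull_phi1_mem hf, Toupie.h1Equiv_symm_mk hI hη f hf⟩,
    fun F G => ⟨Toupie.minBracket_mem hη F G, Toupie.h1Equiv_bracket hI hη F G⟩⟩
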